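/- **Setting.** Let $m\ge 2$ and let $\alpha=(\alpha_1,\dots,\alpha_m)$ be positive reals that are generic: $\sum_k\varepsilon_k\alpha_k\neq 0$ for all choices of signs $\varepsilon_k=\pm1$. Let $$\mathcal M(\alpha)=\Bigl\{(\vec v_1,\dots,\vec v_m)\in(\mathbb R^3)^m : |\vec v_k|=\alpha_k,\ \sum_k\vec v_k=0\Bigr\}\Big/SO(3)$$ be the space of closed polygons modulo rotations, with its quotient smooth structure, of dimension $2(m-3)$ (it is empty for $m=2$), and with the reduced form $\omega$, whose pullback to the set of closed polygons is the restriction of $\sum_k\alpha_k\,\omega_{S^2}$; here $\omega_{S^2}$ is the standard form $(\omega_{S^2})_u(x,y)=\langle u,x\times y\rangle$ on the unit sphere, transported by scaling to the sphere of radius $\alpha_k$. For $i\neq j$ let $D_{i,j}^{\pm}(\alpha)\subset\mathcal M(\alpha)$ be the set of classes of polygons with $\vec v_i$ parallel to $\vec v_j$ and $\pm\langle\vec v_i,\vec v_j\rangle>0$, and let $$\alpha_{i,j}^+=(\alpha_1,\dots,\hat\alpha_i,\dots,\hat\alpha_j,\dots,\alpha_m,\alpha_i+\alpha_j),\qquad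 \alpha_{i,j}^-=(\alpha_1,\dots,\hat\alpha_i,\dots,\hat\alpha_j,\dots,\alpha_m,|\alpha_i-\alpha_j|),$$ where a hat denotes an omitted entry. **Proposition.** Suppose that $\alpha_i\neq\alpha_j$. Then $\mathcal M(\alpha)$, $\mathcal M(\alpha_{i,j}^+)$ and $\mathcal M(\alpha_{i,j}^-)$ with their reduced forms are symplectic manifolds, $D_{i,j}^{+}(\alpha)$ and $D_{i,j}^{-}(\alpha)$ are embedded symplectic submanifolds of $\mathcal M(\alpha)$ with the restriction of $\omega$, and for both signs the map $$s_\pm: D_{i,j}^\pm(\alpha)\longrightarrow\mathcal M(\alpha_{i,j}^\pm),\qquad [(\vec v_1,\dots,\vec v_m)]\longmapsto[(\vec v_1,\dots,\hat{\vec v}_i,\dots,\hat{\vec v}_j,\dots,\vec v_m,\ \vec v_i+\vec v_j)]$$ is a well-defined symplectomorphism: it is a diffeomorphism that pulls the reduced form of $\mathcal M(\alpha_{i,j}^\pm)$ back to $\omega|_{D_{i,j}^\pm(\alpha)}$. -/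

import Mathlib

open scoped Manifold ContDiff

noncomputable section

/-! ### Symplectic forms and symplectomorphisms on smooth manifolds -/

section Symplectic

variable {d d' : ℕ}

/-- Differential 2-forms (not yet assumed smooth) on a manifold modelled on `ℝᵈ`. -/
abbrev TwoForm (d : ℕ) (M : Type*) [TopologicalSpace M]
    [ChartedSpace (EuclideanSpace ℝ (Fin d)) M] :=
  ∀ x : M, TangentSpace (𝓡 d) x [⋀^Fin 2]→L[ℝ] ℝ

variable {M : Type*} [TopologicalSpace M] [ChartedSpace (EuclideanSpace ℝ (Fin d)) M]
variable {N : Type*} [TopologicalSpace N] [ChartedSpace (EuclideanSpace ℝ (Fin d')) N]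

/-- The pullback `f^* Ω`. -/
def TwoForm.pullback (f : M → N) (Ω : TwoForm d' N) : TwoForm d M := fun x =>
  (Ω (f x)).compContinuousLinearMap (mfderiv (𝓡 d) (𝓡 d') f x)

/-- The expression of a 2-form in a chart `φ`, that is `(φ⁻¹)^* Ω` (meaningful on `φ.target`). -/
def TwoForm.inChart (Ω : TwoForm d M)
    (φ : OpenPartialHomeomorph M (EuclideanSpace ℝ (Fin d))) :
    EuclideanSpace ℝ (Fin d) → EuclideanSpace ℝ (Fin d) [⋀^Fin 2]→L[ℝ] ℝ := fun z =>
  TwoForm.pullback (M := EuclideanSpace ℝ (Fin d)) φ.symm Ω z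

/-- A symplectic form: a smooth, closed, nondegenerate 2-form. -/
structure IsSymplecticForm (Ω : TwoForm d M) : Prop where
  smooth : ∀ φ ∈ atlas (EuclideanSpace ℝ (Fin d)) M, ContDiffOn ℝ ∞ (Ω.inChart φ) φ.target
  closed : ∀ φ ∈ atlas (EuclideanSpace ℝ (Fin d)) M, ∀ z ∈ φ.target,
    extDeriv (Ω.inChart φ) z = 0
  nondegenerate : ∀ (x : M) (u : TangentSpace (𝓡 d) x), (∀ w, Ω x ![u, w] = 0) → u = 0

/-- `D ⊆ M` (with the subspace topology) is an embedded submanifold of `M`, of the same dimension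
as `N`, and `s : D → N` is a diffeomorphism for the submanifold structure of `D` that carries the
restriction of `ΩM` to `ΩN`, i.e. `s^* ΩN = ι^* ΩM` with `ι : D → M` the inclusion. The smooth
structure of `D` is unique: it makes the inclusion a smooth immersion and induces the subspace
topology. If `ΩN` is symplectic, then so is `ι^* ΩM`, that is, `D` is a symplectic
submanifold. -/
def IsSubmanifoldSymplectomorphism (ΩM : TwoForm d M) (D : Set M) (ΩN : TwoForm d' N)
    (s : D → N) : Prop :=
  ∃ (_ : ChartedSpace (EuclideanSpace ℝ (Fin d')) D) (_ : IsManifold (𝓡 d') ∞ D),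
    ContMDiff (𝓡 d') (𝓡 d) ∞ (Subtype.val : D → M) ∧
    (∀ x : D, Function.Injective (mfderiv (𝓡 d') (𝓡 d) (Subtype.val : D → M) x)) ∧
    ∃ Φ : D ≃ₘ^∞⟮𝓡 d', 𝓡 d'⟯ N, (∀ x, Φ x = s x) ∧
      TwoForm.pullback (d := d') (M := D) Φ ΩN =
        TwoForm.pullback (d := d') (Subtype.val : D → M) ΩM

end Symplectic

/-! ### Polygon spaces -/

/-- Euclidean 3-space. -/
abbrev E3 := EuclideanSpace ℝ (Fin 3)

variable {m : ℕ}

/-- Diagonal action of a matrix on a list of `m` steps. -/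
def rotate (A : Matrix (Fin 3) (Fin 3) ℝ) (v : Fin m → E3) : Fin m → E3 :=
  fun k => Matrix.toEuclideanLin A (v k)

theorem rotate_one (v : Fin m → E3) : rotate 1 v = v := by
  funext k; ext a; simp [rotate]

theorem rotate_mul (A B : Matrix (Fin 3) (Fin 3) ℝ) (v : Fin m → E3) :
    rotate (A * B) v = rotate A (rotate B v) := by
  funext k; ext a; simp [rotate, Matrix.mulVec_mulVec]

/-- `α` is generic: no signed sum of the lengths vanishes. -/
def IsGeneric (α : Fin m → ℝ) : Prop :=
  ∀ ε : Fin m → ℝ, (∀ k, ε k = 1 ∨ ε k = -1) → ∑ k, ε k * α k ≠ 0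

/-- Closed polygonal paths in `ℝ³` with step lengths `α`. -/
def closedPolygons (α : Fin m → ℝ) : Set (Fin m → E3) :=
  {v | (∀ k, ‖v k‖ = α k) ∧ ∑ k, v k = 0}

/-- Two closed polygons are equivalent when they differ by a rotation. -/
def rotationSetoid (α : Fin m → ℝ) : Setoid (closedPolygons α) where
  r v w := ∃ A ∈ Matrix.specialOrthogonalGroup (Fin 3) ℝ, rotate A v.1 = w.1
  iseqv :=
    { refl := fun v => ⟨1, one_mem _, rotate_one _⟩
      symm := by
        rintro v w ⟨A, hA, h⟩
        refine ⟨((⟨A, hA⟩ : Matrix.specialOrthogonalGroup (Fin 3) ℝ)⁻¹ :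
          Matrix.specialOrthogonalGroup (Fin 3) ℝ).1, Subtype.property _, ?_⟩
        rw [← h, ← rotate_mul]
        have := congrArg Subtype.val
          (inv_mul_cancel (⟨A, hA⟩ : Matrix.specialOrthogonalGroup (Fin 3) ℝ))
        rw [Submonoid.coe_mul, Submonoid.coe_one] at this
        rw [this, rotate_one]
      trans := by
        rintro u v w ⟨A, hA, h⟩ ⟨B, hB, h'⟩
        exact ⟨B * A, mul_mem hB hA, by rw [rotate_mul, h, h']⟩ }

/-- The polygon space `M(α)`, with the quotient topology. -/
abbrev PolygonSpace (α : Fin m → ℝ) := Quotient (rotationSetoid α)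

/-- The class of a closed polygon. -/
abbrev PolygonSpace.mk {α : Fin m → ℝ} (v : closedPolygons α) : PolygonSpace α :=
  Quotient.mk (rotationSetoid α) v

/-- `p` is, on the open set `V`, the composition of the projection to `M(α)` with the map `σ`,
which is smooth (as a map to `(ℝ³)ᵐ`) and takes values in the closed polygons. -/
def IsSmoothLift {d : ℕ} (α : Fin m → ℝ) (V : Set (EuclideanSpace ℝ (Fin d)))
    (σ : EuclideanSpace ℝ (Fin d) → Fin m → E3)
    (p : EuclideanSpace ℝ (Fin d) → PolygonSpace α) : Prop :=
  IsOpen V ∧ ContDiffOn ℝ ∞ σ V ∧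
    ∀ z ∈ V, ∃ h : σ z ∈ closedPolygons α, p z = PolygonSpace.mk ⟨σ z, h⟩

/-- A chart of the quotient smooth structure of `M(α)`, of dimension `2(m-3)`: a homeomorphism from
an open subset of `M(α)` to an open subset of Euclidean space, whose composition with the projection
is a smooth function of the polygon (locally the restriction of a smooth function on `(ℝ³)ᵐ`) and
whose inverse locally lifts to a smooth family of closed polygons. -/
structure IsPolygonChart (α : Fin m → ℝ)
    (φ : OpenPartialHomeomorph (PolygonSpace α) (EuclideanSpace ℝ (Fin (2 * (m - 3))))) :
    Prop where
  smooth : ∀ v : closedPolygons α, PolygonSpace.mk v ∈ φ.source →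
    ∃ (U : Set (Fin m → E3)) (F : (Fin m → E3) → EuclideanSpace ℝ (Fin (2 * (m - 3)))),
      IsOpen U ∧ v.1 ∈ U ∧ ContDiffOn ℝ ∞ F U ∧
      ∀ w : closedPolygons α, w.1 ∈ U → φ (PolygonSpace.mk w) = F w.1
  smooth_lift : ∀ z ∈ φ.target, ∃ V σ, z ∈ V ∧ IsSmoothLift α V σ φ.symm

/-- `M(α)` is a smooth manifold of dimension `2(m-3)` for its quotient smooth structure:
it is covered by charts. (The topology of `M(α)` is that of a quotient of a compact metrizable space
by a compact group, so it is always compact, Hausdorff and second countable.) -/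
class IsPolygonManifold (α : Fin m → ℝ) : Prop where
  exists_chart : ∀ x : PolygonSpace α, ∃ φ, IsPolygonChart α φ ∧ x ∈ φ.source

instance polygonChartedSpace (α : Fin m → ℝ) [h : IsPolygonManifold α] :
    ChartedSpace (EuclideanSpace ℝ (Fin (2 * (m - 3)))) (PolygonSpace α) where
  atlas := {φ | IsPolygonChart α φ}
  chartAt x := (h.exists_chart x).choose
  mem_chart_source x := (h.exists_chart x).choose_spec.2
  chart_mem_atlas x := (h.exists_chart x).choose_spec.1

instance polygonIsManifold (α : Fin m → ℝ) [h : IsPolygonManifold α] :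
    IsManifold (𝓡 (2 * (m - 3))) ∞ (PolygonSpace α) := by
  refine isManifold_of_contDiffOn _ _ _ fun e e' he he' => ?_
  have he : IsPolygonChart α e := he
  have he' : IsPolygonChart α e' := he'
  intro z hz
  have hz1 : z ∈ (e.symm ≫ₕ e').source := hz.1
  rw [OpenPartialHomeomorph.trans_source] at hz1
  obtain ⟨V, σ, hzV, hV, hσ, hl⟩ := he.smooth_lift z hz1.1
  obtain ⟨h0, hp0⟩ := hl z hzV
  have hsrc : PolygonSpace.mk ⟨σ z, h0⟩ ∈ e'.source := by
    rw [← hp0]; exact hz1.2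
  obtain ⟨U, F, hU, hzU, hF, hφ⟩ := he'.smooth ⟨σ z, h0⟩ hsrc
  have hσz : ContDiffAt ℝ ∞ σ z := hσ.contDiffAt (hV.mem_nhds hzV)
  have hcomp : ContDiffAt ℝ ∞ (F ∘ σ) z :=
    ContDiffAt.comp z (hF.contDiffAt (hU.mem_nhds hzU)) hσz
  refine (hcomp.congr_of_eventuallyEq ?_).contDiffWithinAt
  filter_upwards [hV.mem_nhds hzV, hσz.continuousAt.preimage_mem_nhds (hU.mem_nhds hzU)]
    with y hyV hyU
  obtain ⟨hy, hpy⟩ := hl y hyV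
  change e' (e.symm y) = F (σ y)
  rw [hpy]
  exact hφ ⟨σ y, hy⟩ hyU

/-- The standard symplectic form of the unit sphere, `(ω_{S²})_u (x, y) = ⟨u, x × y⟩`. -/
def sphereForm (u x y : E3) : ℝ := dotProduct u.ofLp (crossProduct x.ofLp y.ofLp)

/-- The product form `α₁ ω_{S²} + ⋯ + αₘ ω_{S²}` on the product of the spheres of radii `αₖ`, where
the sphere of radius `αₖ` is identified with the unit sphere by scaling. -/
def productForm (α : Fin m → ℝ) (v x y : Fin m → E3) : ℝ :=
  ∑ k, α k * sphereForm ((α k)⁻¹ • v k) ((α k)⁻¹ • x k) ((α k)⁻¹ • y k)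

/-- `Ω` is the reduced form on `M(α)`: its pullback to the set of closed polygons is the restriction
of the product form. Both are compared on all smooth families of closed polygons. -/
def IsReducedForm (α : Fin m → ℝ) [IsPolygonManifold α]
    (Ω : TwoForm (2 * (m - 3)) (PolygonSpace α)) : Prop :=
  ∀ (d : ℕ) (V : Set (EuclideanSpace ℝ (Fin d))) (σ : EuclideanSpace ℝ (Fin d) → Fin m → E3)
    (p : EuclideanSpace ℝ (Fin d) → PolygonSpace α), IsSmoothLift α V σ p →
    ∀ z ∈ V, ∀ a b : EuclideanSpace ℝ (Fin d),
      TwoForm.pullback p Ω z ![a, b] =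
        productForm α (σ z) (fderiv ℝ σ z a) (fderiv ℝ σ z b)

/-! ### Polygons with two parallel steps -/

/-- `D_{i,j}(α)`: classes of polygons whose steps `i` and `j` are parallel (for nonzero steps). -/
def parallelLocus (α : Fin m → ℝ) (i j : Fin m) : Set (PolygonSpace α) :=
  {p | ∃ v : closedPolygons α, PolygonSpace.mk v = p ∧ ∃ c : ℝ, v.1 j = c • v.1 i}

/-- `D_{i,j}^+(α)`. -/
def parallelLocusPos (α : Fin m → ℝ) (i j : Fin m) : Set (PolygonSpace α) :=
  {p ∈ parallelLocus α i j | ∃ v : closedPolygons α, PolygonSpace.mk v = p ∧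
    0 < inner ℝ (v.1 i) (v.1 j)}

/-- `D_{i,j}^-(α)`. -/
def parallelLocusNeg (α : Fin m → ℝ) (i j : Fin m) : Set (PolygonSpace α) :=
  {p ∈ parallelLocus α i j | ∃ v : closedPolygons α, PolygonSpace.mk v = p ∧
    inner ℝ (v.1 i) (v.1 j) < 0}

/-- The increasing enumeration of the indices other than `i` and `j`. -/
def otherIndices {n : ℕ} (i j : Fin (n + 2)) (hij : i ≠ j) : Fin n ↪o Fin (n + 2) :=
  (({i, j} : Finset (Fin (n + 2)))ᶜ).orderEmbOfFin
    (by rw [Finset.card_compl, Finset.card_pair hij, Fintype.card_fin]; rfl)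

/-- The list `(f₁, …, f̂ᵢ, …, f̂ⱼ, …, f_{n+2}, x)`. -/
def dropTwoAppend {n : ℕ} {X : Type*} (i j : Fin (n + 2)) (hij : i ≠ j)
    (f : Fin (n + 2) → X) (x : X) : Fin (n + 1) → X :=
  Fin.snoc (α := fun _ => X) (fun k => f (otherIndices i j hij k)) x

/-- `α_{i,j}^+`. -/
def lengthsPos {n : ℕ} (α : Fin (n + 2) → ℝ) (i j : Fin (n + 2)) (hij : i ≠ j) :
    Fin (n + 1) → ℝ :=
  dropTwoAppend i j hij α (α i + α j)

/-- `α_{i,j}^-`. -/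
def lengthsNeg {n : ℕ} (α : Fin (n + 2) → ℝ) (i j : Fin (n + 2)) (hij : i ≠ j) :
    Fin (n + 1) → ℝ :=
  dropTwoAppend i j hij α |α i - α j|

/-- The polygon obtained by removing the steps `i` and `j` and appending their sum. -/
def mergeSteps {n : ℕ} (i j : Fin (n + 2)) (hij : i ≠ j) (v : Fin (n + 2) → E3) :
    Fin (n + 1) → E3 :=
  dropTwoAppend i j hij v (v i + v j)

end

/-! On $D_{i,j}^\pm$ the steps $i,j$ are in a fixed ratio $c:c'$ with $c+c'=1$:
$c=\alpha_i/(\alpha_i\pm\alpha_j)$ and $c'=\pm\alpha_j/(\alpha_i\pm\alpha_j)$. So merging is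
inverted by the linear map `splitSteps`, which replaces the last step $x$ by $cx$ and $c'x$ and
commutes with rotations. With $\gamma$ the length of the merged step, the weight of a step of length
$r$ in the product form is $r^{-2}$ and the triple product is cubic, so the two new steps contribute
$c\gamma^{-2}+c'\gamma^{-2}=\gamma^{-2}$ times the triple product of the old one. Hence splitting
preserves the product form (`productForm_splitSteps`). It descends to a smooth map of quotients
which pulls the reduced form back to the reduced form (`contMDiff_splitMap`, `pullback_splitMap`)
and is a homeomorphism onto $D_{i,j}^\pm$ (`mergeHomeomorph`). The smooth structure of $D_{i,j}^\pm$
is transported along it; the inclusion is an immersion because the form on the merged space is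
nondegenerate (`isSubmanifoldSymplectomorphism_of_homeomorph`).

The quotients are manifolds because a generic closed polygon is not contained in a line
(`exists_cross_ne_zero`). Two independent steps then determine an oriented frame, and the
coordinates in it give a normalized representative of each nearby class. Normalized closed polygons
are a level set of a submersion, a slice for the rotations, and the inverse function theorem gives
charts of dimension $3m-(m+3+3)$ (`exists_slice_coordinates`, `exists_isPolygonChart`).

The reduced form is the pullback of the product form by any local lift. It does not depend on the
lift (`familyForm_eq_of_sameClassesAt`) because infinitesimal rotations are in the kernel of the
product form: the closing vector $\sum_k v_k$ is a moment map. It is closed because three vectors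
tangent to a 2-sphere at a point are dependent (`extDeriv_familyForm`), and nondegenerate because,
by Lagrange multipliers, the kernel contains nothing but infinitesimal rotations
(`exists_eq_infRot`). -/

/-! ### Triple products and rotations in coordinates -/

theorem inner_eq_coords (x y : E3) : inner ℝ x y = x 0 * y 0 + x 1 * y 1 + x 2 * y 2 := by
  simp [PiLp.inner_apply, Fin.sum_univ_three, mul_comm]

theorem sphereForm_eq (u x y : E3) : sphereForm u x y =
    u 0 * (x 1 * y 2 - x 2 * y 1) + u 1 * (x 2 * y 0 - x 0 * y 2) +
      u 2 * (x 0 * y 1 - x 1 * y 0) := by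
  simp [sphereForm, cross_apply, dotProduct, Fin.sum_univ_three]

/-- The cross product on `E3`. -/
noncomputable def cross (x y : E3) : E3 := WithLp.toLp 2 (crossProduct x.ofLp y.ofLp)

@[simp] theorem cross_zero_coord (x y : E3) : cross x y 0 = x 1 * y 2 - x 2 * y 1 := by
  simp [cross, cross_apply]
@[simp] theorem cross_one_coord (x y : E3) : cross x y 1 = x 2 * y 0 - x 0 * y 2 := by
  simp [cross, cross_apply]
@[simp] theorem cross_two_coord (x y : E3) : cross x y 2 = x 0 * y 1 - x 1 * y 0 := by
  simp [cross, cross_apply]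

theorem E3.ext_coords {x y : E3} (h0 : x 0 = y 0) (h1 : x 1 = y 1) (h2 : x 2 = y 2) : x = y := by
  ext i; fin_cases i <;> assumption

/-- For `y` tangent to the sphere at `v` the second term vanishes. What remains is $|v|^2$ times the
differential of the height function of axis `κ`, the Hamiltonian of the rotation about `κ`. -/
theorem sphereForm_cross (v κ y : E3) : sphereForm v (cross κ v) y =
    inner ℝ v v * inner ℝ κ y - inner ℝ κ v * inner ℝ v y := by
  simp only [sphereForm_eq, inner_eq_coords, cross_zero_coord, cross_one_coord, cross_two_coord]
  ring

theorem sphereForm_swap (u x y : E3) : sphereForm u x y = -sphereForm u y x := by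
  simp only [sphereForm_eq]; ring

theorem inner_cross_self (v κ : E3) : inner ℝ v (cross κ v) = 0 := by
  simp only [inner_eq_coords, cross_zero_coord, cross_one_coord, cross_two_coord]; ring

theorem sphereForm_eq_zero_of_orthogonal {v x y z : E3} (hv : v ≠ 0) (hx : inner ℝ v x = 0)
    (hy : inner ℝ v y = 0) (hz : inner ℝ v z = 0) : sphereForm x y z = 0 := by
  -- Coordinates of Cramer's identity $\det(x,y,z)\,v=\langle v,x\rangle\,y\times z+\langle
  -- v,y\rangle\,z\times x+\langle v,z\rangle\,x\times y$.
  have key : ∀ i, v i * sphereForm x y z = 0 := by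
    intro i
    rw [inner_eq_coords] at hx hy hz
    rw [sphereForm_eq]
    fin_cases i
    · change v 0 * _ = 0
      linear_combination (y 1 * z 2 - y 2 * z 1) * hx + (z 1 * x 2 - z 2 * x 1) * hy +
        (x 1 * y 2 - x 2 * y 1) * hz
    · change v 1 * _ = 0
      linear_combination (y 2 * z 0 - y 0 * z 2) * hx + (z 2 * x 0 - z 0 * x 2) * hy +
        (x 2 * y 0 - x 0 * y 2) * hz
    · change v 2 * _ = 0
      linear_combination (y 0 * z 1 - y 1 * z 0) * hx + (z 0 * x 1 - z 1 * x 0) * hy +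
        (x 0 * y 1 - x 1 * y 0) * hz
  by_contra h
  exact hv (by ext i; simpa [h] using key i)

/-- The action of a matrix on `E3`. -/
noncomputable abbrev act (A : Matrix (Fin 3) (Fin 3) ℝ) (x : E3) : E3 := Matrix.toEuclideanLin A x

theorem act_apply (A : Matrix (Fin 3) (Fin 3) ℝ) (x : E3) (i : Fin 3) :
    act A x i = A i 0 * x 0 + A i 1 * x 1 + A i 2 * x 2 := by
  simp [act, Matrix.mulVec, dotProduct, Fin.sum_univ_three]

theorem inner_act {A : Matrix (Fin 3) (Fin 3) ℝ} (hA : A ∈ Matrix.specialOrthogonalGroup (Fin 3) ℝ)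
    (x y : E3) : inner ℝ (act A x) (act A y) = inner ℝ x y := by
  have h := (Matrix.mem_orthogonalGroup_iff' (Fin 3) ℝ).1
    (Matrix.mem_specialOrthogonalGroup_iff.1 hA).1
  have e : ∀ i j, A 0 i * A 0 j + A 1 i * A 1 j + A 2 i * A 2 j = (1 : Matrix _ _ ℝ) i j := by
    intro i j
    rw [← h]; simp [Matrix.mul_apply, Fin.sum_univ_three]
  have e00 := e 0 0; have e01 := e 0 1; have e02 := e 0 2
  have e11 := e 1 1; have e12 := e 1 2; have e22 := e 2 2
  simp at e00 e01 e02 e11 e12 e22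
  simp only [inner_eq_coords, act_apply]
  linear_combination (x 0 * y 0) * e00 + (x 0 * y 1 + x 1 * y 0) * e01 +
    (x 0 * y 2 + x 2 * y 0) * e02 + (x 1 * y 1) * e11 + (x 1 * y 2 + x 2 * y 1) * e12 +
    (x 2 * y 2) * e22

theorem norm_act {A : Matrix (Fin 3) (Fin 3) ℝ} (hA : A ∈ Matrix.specialOrthogonalGroup (Fin 3) ℝ)
    (x : E3) : ‖act A x‖ = ‖x‖ := by
  rw [@norm_eq_sqrt_real_inner _ _ _ (act A x), @norm_eq_sqrt_real_inner _ _ _ x, inner_act hA]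

/-- The triple product is a determinant, so `A` multiplies it by $\det A=1$. -/
theorem sphereForm_act {A : Matrix (Fin 3) (Fin 3) ℝ}
    (hA : A ∈ Matrix.specialOrthogonalGroup (Fin 3) ℝ) (x y z : E3) :
    sphereForm (act A x) (act A y) (act A z) = sphereForm x y z := by
  have h := (Matrix.mem_specialOrthogonalGroup_iff.1 hA).2
  rw [Matrix.det_fin_three] at h
  simp only [sphereForm_eq, act_apply]
  linear_combination (sphereForm x y z) * h +
    (A 0 0 * A 1 1 * A 2 2 - A 0 0 * A 1 2 * A 2 1 - A 0 1 * A 1 0 * A 2 2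
      + A 0 1 * A 1 2 * A 2 0 + A 0 2 * A 1 0 * A 2 1 - A 0 2 * A 1 1 * A 2 0) *
      (-sphereForm_eq x y z) + sphereForm_eq x y z

/-! ### The product form on closed polygons -/

section Polygons

variable {m : ℕ}

theorem productForm_eq (α : Fin m → ℝ) (v x y : Fin m → E3) :
    productForm α v x y = ∑ k, α k * (α k)⁻¹ ^ 3 * sphereForm (v k) (x k) (y k) := by
  refine Finset.sum_congr rfl fun k _ => ?_
  simp only [sphereForm_eq, PiLp.smul_apply, smul_eq_mul]
  ring

/-- The tangency conditions to the set of closed polygons at `v`. -/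
def IsTangent (v x : Fin m → E3) : Prop := (∀ k, inner ℝ (v k) (x k) = 0) ∧ ∑ k, x k = 0

/-- The infinitesimal rotation with axis `κ`. -/
noncomputable def infRot (κ : E3) (v : Fin m → E3) : Fin m → E3 := fun k => cross κ (v k)

theorem sum_coord (v : Fin m → E3) (i : Fin 3) : (∑ k, v k) i = ∑ k, v k i := by
  simp [WithLp.ofLp_sum]

theorem isTangent_infRot {v : Fin m → E3} (hv : ∑ k, v k = 0) (κ : E3) :
    IsTangent v (infRot κ v) := by
  refine ⟨fun k => inner_cross_self _ _, ?_⟩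
  have h : ∀ i, ∑ k, v k i = 0 := fun i => by rw [← sum_coord, hv]; rfl
  apply E3.ext_coords <;> rw [sum_coord] <;>
    simp [infRot, Finset.sum_sub_distrib, ← Finset.mul_sum, h]

theorem IsTangent.add {v x y : Fin m → E3} (hx : IsTangent v x) (hy : IsTangent v y) :
    IsTangent v (x + y) :=
  ⟨fun k => by simp [inner_add_right, hx.1 k, hy.1 k],
    by simp [Finset.sum_add_distrib, hx.2, hy.2]⟩

theorem productForm_swap (α : Fin m → ℝ) (v x y : Fin m → E3) :
    productForm α v x y = -productForm α v y x := by
  simp only [productForm_eq, ← Finset.sum_neg_distrib]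
  exact Finset.sum_congr rfl fun k _ => by rw [sphereForm_swap]; ring

/-- The moment map property: each weight cancels the squared radius in `sphereForm_cross`, leaving
$\sum_k\langle\kappa,y_k\rangle=\langle\kappa,\sum_k y_k\rangle$, which vanishes for a variation
that keeps the polygon closed. -/
theorem productForm_infRot {α : Fin m → ℝ} (hα : ∀ k, 0 < α k) {v y : Fin m → E3}
    (hv : v ∈ closedPolygons α) (hy : IsTangent v y) (κ : E3) :
    productForm α v (infRot κ v) y = 0 := by
  have : productForm α v (infRot κ v) y = ∑ k, inner ℝ κ (y k) := by
    rw [productForm_eq]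
    refine Finset.sum_congr rfl fun k _ => ?_
    rw [infRot, sphereForm_cross, hy.1 k, real_inner_self_eq_norm_sq, hv.1 k]
    have := (hα k).ne'
    field_simp
    ring
  rw [this, ← inner_sum, hy.2, inner_zero_right]

theorem productForm_add_left (α : Fin m → ℝ) (v x x' y : Fin m → E3) :
    productForm α v (x + x') y = productForm α v x y + productForm α v x' y := by
  simp only [productForm_eq, ← Finset.sum_add_distrib]
  exact Finset.sum_congr rfl fun k _ => by simp [sphereForm_eq]; ring

theorem productForm_smul_left (α : Fin m → ℝ) (c : ℝ) (v x y : Fin m → E3) :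
    productForm α v (c • x) y = c * productForm α v x y := by
  simp only [productForm_eq, Finset.mul_sum]
  exact Finset.sum_congr rfl fun k _ => by simp [sphereForm_eq]; ring

theorem productForm_add_right (α : Fin m → ℝ) (v x y y' : Fin m → E3) :
    productForm α v x (y + y') = productForm α v x y + productForm α v x y' := by
  rw [productForm_swap, productForm_add_left, productForm_swap α v y, productForm_swap α v y']; ring

theorem productForm_smul_right (α : Fin m → ℝ) (c : ℝ) (v x y : Fin m → E3) :
    productForm α v x (c • y) = c * productForm α v x y := by
  rw [productForm_swap, productForm_smul_left, productForm_swap α v y]; ring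

theorem productForm_rotate {A : Matrix (Fin 3) (Fin 3) ℝ}
    (hA : A ∈ Matrix.specialOrthogonalGroup (Fin 3) ℝ) (α : Fin m → ℝ) (v x y : Fin m → E3) :
    productForm α (rotate A v) (rotate A x) (rotate A y) = productForm α v x y := by
  simp only [productForm_eq]
  exact Finset.sum_congr rfl fun k _ => by rw [← sphereForm_act hA (v k)]; rfl

theorem rotate_mem_closedPolygons {A : Matrix (Fin 3) (Fin 3) ℝ}
    (hA : A ∈ Matrix.specialOrthogonalGroup (Fin 3) ℝ) {α : Fin m → ℝ} {v : Fin m → E3}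
    (hv : v ∈ closedPolygons α) : rotate A v ∈ closedPolygons α := by
  refine ⟨fun k => (norm_act hA _).trans (hv.1 k), ?_⟩
  simp only [rotate]
  rw [← map_sum, hv.2, map_zero]

theorem IsTangent.rotate {A : Matrix (Fin 3) (Fin 3) ℝ}
    (hA : A ∈ Matrix.specialOrthogonalGroup (Fin 3) ℝ) {v x : Fin m → E3} (hx : IsTangent v x) :
    IsTangent (rotate A v) (rotate A x) := by
  refine ⟨fun k => (inner_act hA _ _).trans (hx.1 k), ?_⟩
  simp only [_root_.rotate]
  rw [← map_sum, hx.2, map_zero]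

/-- The product form is basic on closed polygons. -/
theorem productForm_rotate_add_infRot {A : Matrix (Fin 3) (Fin 3) ℝ}
    (hA : A ∈ Matrix.specialOrthogonalGroup (Fin 3) ℝ) {α : Fin m → ℝ} (hα : ∀ k, 0 < α k)
    {v x y : Fin m → E3} (hv : v ∈ closedPolygons α) (hx : IsTangent v x) (hy : IsTangent v y)
    (κ μ : E3) :
    productForm α (rotate A v) (rotate A x + infRot κ (rotate A v))
      (rotate A y + infRot μ (rotate A v)) = productForm α v x y := by
  have hv' := rotate_mem_closedPolygons hA hv
  have hx' := hx.rotate hA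
  -- The whole second argument, including its infinitesimal rotation, must be tangent before that of
  -- the first argument can be dropped.
  have hy' := (hy.rotate hA).add (isTangent_infRot hv'.2 μ)
  rw [productForm_add_left, productForm_infRot hα hv' hy', add_zero, productForm_add_right,
    productForm_swap α _ _ (infRot μ _), productForm_infRot hα hv' hx', productForm_rotate hA]
  simp

theorem productForm_self (α : Fin m → ℝ) (v x : Fin m → E3) : productForm α v x x = 0 := by
  have := productForm_swap α v x x
  linarith

theorem continuous_productForm (α : Fin m → ℝ) (v : Fin m → E3) :
    Continuous fun w : Fin 2 → Fin m → E3 => productForm α v (w 0) (w 1) := by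
  simp only [productForm_eq, sphereForm_eq]
  fun_prop

/-- The product form at `v`, as an alternating map. -/
noncomputable def productFormAlt (α : Fin m → ℝ) (v : Fin m → E3) :
    (Fin m → E3) [⋀^Fin 2]→L[ℝ] ℝ where
  toFun w := productForm α v (w 0) (w 1)
  map_update_add' w i x y := by
    fin_cases i <;> simp [Function.update, productForm_add_left, productForm_add_right]
  map_update_smul' w i c x := by
    fin_cases i <;> simp [Function.update, productForm_smul_left, productForm_smul_right]
  cont := continuous_productForm α v
  map_eq_zero_of_eq' w i j h hij := by
    have h01 : w 0 = w 1 := by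
      fin_cases i <;> fin_cases j <;> first | exact absurd rfl hij | exact h | exact h.symm
    change productForm α v (w 0) (w 1) = 0
    rw [h01, productForm_self]

theorem productFormAlt_apply (α : Fin m → ℝ) (v : Fin m → E3) (w : Fin 2 → Fin m → E3) :
    productFormAlt α v w = productForm α v (w 0) (w 1) := rfl

/-- The product form as a 2-form on `(ℝ³)ᵐ` with linear coefficients. -/
noncomputable def productFormCLM (α : Fin m → ℝ) :
    (Fin m → E3) →L[ℝ] (Fin m → E3) [⋀^Fin 2]→L[ℝ] ℝ :=
  LinearMap.toContinuousLinearMap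
    { toFun := productFormAlt α
      map_add' := fun v v' => by
        ext w
        simp only [ContinuousAlternatingMap.add_apply, productFormAlt_apply, productForm_eq,
          ← Finset.sum_add_distrib]
        exact Finset.sum_congr rfl fun k _ => by simp [sphereForm_eq]; ring
      map_smul' := fun c v => by
        ext w
        simp only [ContinuousAlternatingMap.smul_apply, productFormAlt_apply, productForm_eq,
          RingHom.id_apply, smul_eq_mul, Finset.mul_sum]
        exact Finset.sum_congr rfl fun k _ => by simp [sphereForm_eq]; ring }

end Polygons

/-! ### Smoothness of pullbacks of alternating forms -/

section AlternatingCalculus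

variable {ι E F G H : Type*} [Fintype ι] [DecidableEq ι]
  [NormedAddCommGroup E] [NormedSpace ℝ E] [NormedAddCommGroup F] [NormedSpace ℝ F]
  [NormedAddCommGroup G] [NormedSpace ℝ G] [NormedAddCommGroup H] [NormedSpace ℝ H]

/-- Alternatization as a continuous linear map. -/
noncomputable def alternatizationCLM :
    ContinuousMultilinearMap ℝ (fun _ : ι => E) F →L[ℝ] E [⋀^ι]→L[ℝ] F :=
  LinearMap.mkContinuous
    { toFun := ContinuousMultilinearMap.alternatization
      map_add' := map_add _
      map_smul' := fun c f => by
        ext v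
        simp only [ContinuousMultilinearMap.alternatization_apply_apply,
          ContinuousAlternatingMap.smul_apply, smul_apply,
          RingHom.id_apply, Finset.smul_sum]
        exact Finset.sum_congr rfl fun s _ => smul_comm _ _ _ }
    (Fintype.card (Equiv.Perm ι)) (fun f => by
      refine ContinuousAlternatingMap.opNorm_le_bound _ (by positivity) fun v => ?_
      change ‖ContinuousMultilinearMap.alternatization f v‖ ≤ _
      rw [ContinuousMultilinearMap.alternatization_apply_apply]
      calc ‖∑ s : Equiv.Perm ι, Equiv.Perm.sign s • f (v ∘ s)‖
          ≤ ∑ _s : Equiv.Perm ι, ‖f‖ * ∏ i, ‖v i‖ := by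
            refine norm_sum_le_of_le _ fun s _ => ?_
            have h1 : ‖f (v ∘ s)‖ ≤ ‖f‖ * ∏ i, ‖v i‖ := by
              refine (f.le_opNorm _).trans_eq ?_
              simp only [Function.comp_apply]
              rw [Equiv.prod_comp s fun i => ‖v i‖]
            rcases Int.units_eq_one_or (Equiv.Perm.sign s) with h | h <;> simpa [h] using h1
        _ = _ := by simp [mul_assoc])

theorem alternatizationCLM_apply (f : ContinuousMultilinearMap ℝ (fun _ : ι => E) F) :
    alternatizationCLM f = ContinuousMultilinearMap.alternatization f := rfl

/-- All $n!$ summands of the alternatization of an alternating map are equal to it. -/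
theorem alternatizationCLM_coe (f : E [⋀^ι]→L[ℝ] F) :
    alternatizationCLM f.toContinuousMultilinearMap = (Nat.factorial (Fintype.card ι) : ℝ) • f := by
  ext v
  rw [alternatizationCLM_apply, ContinuousMultilinearMap.alternatization_apply_apply,
    ContinuousAlternatingMap.smul_apply, Nat.cast_smul_eq_nsmul, ← Fintype.card_perm,
    ← Finset.card_univ]
  refine Finset.sum_eq_card_nsmul fun s _ => ?_
  change Equiv.Perm.sign s • f (v ∘ s) = f v
  have := f.toAlternatingMap.map_perm v s
  change f (v ∘ s) = Equiv.Perm.sign s • f v at this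
  rw [this, smul_smul, Int.units_mul_self, one_smul]

/-- For multilinear maps, composition is linear in the form and continuous multilinear in the linear
maps, hence smooth in both. Alternating maps reduce to this case through $1/n!$ times the
alternatization. -/
theorem ContDiffAt.compContinuousLinearMap {n : WithTop ℕ∞} {f : G → E [⋀^ι]→L[ℝ] F}
    {L : G → H →L[ℝ] E} {z : G} (hf : ContDiffAt ℝ n f z) (hL : ContDiffAt ℝ n L z) :
    ContDiffAt ℝ n (fun y => (f y).compContinuousLinearMap (L y)) z := by
  have hfac : (Nat.factorial (Fintype.card ι) : ℝ) ≠ 0 := by positivity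
  have h1 : (fun y => (f y).compContinuousLinearMap (L y)) = fun y =>
      (Nat.factorial (Fintype.card ι) : ℝ)⁻¹ • alternatizationCLM
        (ContinuousMultilinearMap.compContinuousLinearMapContinuousMultilinear ℝ
          (fun _ : ι => H) (fun _ : ι => E) F (fun _ => L y)
          (ContinuousAlternatingMap.toContinuousMultilinearMapCLM ℝ (f y))) := by
    funext y
    have := alternatizationCLM_coe ((f y).compContinuousLinearMap (L y))
    rw [← inv_smul_eq_iff₀ hfac] at this
    exact this.symm
  rw [h1]
  refine ContDiffAt.const_smul (f := fun y => alternatizationCLM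
        (ContinuousMultilinearMap.compContinuousLinearMapContinuousMultilinear ℝ
          (fun _ : ι => H) (fun _ : ι => E) F (fun _ => L y)
          (ContinuousAlternatingMap.toContinuousMultilinearMapCLM ℝ (f y)))) _ ?_
  refine ContDiffAt.comp z (ContinuousLinearMap.contDiff _).contDiffAt ?_
  refine ContDiffAt.clm_apply ?_ ?_
  · exact (ContinuousMultilinearMap.contDiff _).contDiffAt.comp z (contDiffAt_pi.2 fun _ => hL)
  · exact (ContinuousLinearMap.contDiff _).contDiffAt.comp z hf

end AlternatingCalculus

/-! ### Families of polygons and their forms -/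

section Families

variable {m : ℕ} {V : Type*} [NormedAddCommGroup V] [NormedSpace ℝ V]

/-- The pullback of the product form by a family of polygons. -/
noncomputable def familyForm (α : Fin m → ℝ) (σ : V → Fin m → E3) (z : V) : V [⋀^Fin 2]→L[ℝ] ℝ :=
  (productFormCLM α (σ z)).compContinuousLinearMap (fderiv ℝ σ z)

theorem familyForm_apply (α : Fin m → ℝ) (σ : V → Fin m → E3) (z a b : V) :
    familyForm α σ z ![a, b] = productForm α (σ z) (fderiv ℝ σ z a) (fderiv ℝ σ z b) := rfl

theorem ContDiffAt.familyForm {α : Fin m → ℝ} {σ : V → Fin m → E3} {z : V}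
    (hσ : ContDiffAt ℝ ∞ σ z) : ContDiffAt ℝ ∞ (familyForm α σ) z :=
  ((productFormCLM α).contDiff.contDiffAt.comp z hσ).compContinuousLinearMap
    (hσ.fderiv_right (by simp))

/-- Differentiate the equations $|\sigma_k|^2=\alpha_k^2$ and $\sum_k\sigma_k=0$. -/
theorem isTangent_of_hasFDerivAt {α : Fin m → ℝ} {σ : V → Fin m → E3} {z : V}
    {σ' : V →L[ℝ] Fin m → E3} (hσ : HasFDerivAt σ σ' z)
    (hcl : ∀ᶠ y in nhds z, σ y ∈ closedPolygons α) (a : V) : IsTangent (σ z) (σ' a) := by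
  have hk := hasFDerivAt_pi'.1 hσ
  constructor
  · intro k
    have h1 := (hk k).inner ℝ (hk k)
    have h2 : (fun y => inner ℝ (σ y k) (σ y k)) =ᶠ[nhds z] fun _ => (α k) ^ 2 := by
      filter_upwards [hcl] with y hy
      rw [real_inner_self_eq_norm_sq, hy.1 k]
    have h3 := DFunLike.congr_fun
      (h1.unique ((hasFDerivAt_const _ _).congr_of_eventuallyEq h2)) a
    simp [real_inner_comm (σ' a k)] at h3
    rw [real_inner_comm]
    linarith
  · have h1 := HasFDerivAt.fun_sum (u := Finset.univ) fun k _ => hk k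
    have h2 : (fun y => ∑ k, σ y k) =ᶠ[nhds z] fun _ => 0 := by
      filter_upwards [hcl] with y hy using hy.2
    have h3 := DFunLike.congr_fun
      (h1.unique ((hasFDerivAt_const _ _).congr_of_eventuallyEq h2)) a
    simpa using h3

/-- The coefficients are linear in `v`, so differentiating puts the direction in place of `v`. The
three signed terms are cyclic permutations of one triple product, whence the factor 3. -/
theorem extDeriv_productFormCLM_apply (α : Fin m → ℝ) (v : Fin m → E3) (w : Fin 3 → Fin m → E3) :
    extDeriv (fun v => productFormCLM α v) v w =
      ∑ k, 3 * (α k * (α k)⁻¹ ^ 3) * sphereForm (w 0 k) (w 1 k) (w 2 k) := by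
  rw [extDeriv_apply (productFormCLM α).differentiableAt]
  have hd : ∀ (u : Fin 2 → Fin m → E3) (y : Fin m → E3),
      fderiv ℝ (fun x => productFormCLM α x u) v y = productForm α y (u 0) (u 1) := fun u y => by
    have h : HasFDerivAt (fun x => productFormCLM α x u)
        ((ContinuousAlternatingMap.apply ℝ (Fin m → E3) ℝ u).comp (productFormCLM α)) v :=
      (ContinuousAlternatingMap.apply ℝ (Fin m → E3) ℝ u).hasFDerivAt.comp v
        (productFormCLM α).hasFDerivAt
    rw [h.fderiv]
    rfl
  simp only [hd, productForm_eq]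
  rw [Fin.sum_univ_three]
  simp only [Fin.removeNth, Finset.smul_sum, ← Finset.sum_add_distrib]
  refine Finset.sum_congr rfl fun k _ => ?_
  have h10 : Fin.succAbove (0 : Fin 3) (0 : Fin 2) = 1 := rfl
  have h11 : Fin.succAbove (0 : Fin 3) (1 : Fin 2) = 2 := rfl
  have h20 : Fin.succAbove (1 : Fin 3) (0 : Fin 2) = 0 := rfl
  have h21 : Fin.succAbove (1 : Fin 3) (1 : Fin 2) = 2 := rfl
  have h30 : Fin.succAbove (2 : Fin 3) (0 : Fin 2) = 0 := rfl
  have h31 : Fin.succAbove (2 : Fin 3) (1 : Fin 2) = 1 := rfl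
  simp only [h10, h11, h20, h21, h30, h31, sphereForm_eq]
  simp
  ring

/-- The exterior derivative commutes with pullback, and each summand of the pulled-back 3-form is a
triple product of vectors orthogonal to the same nonzero step. -/
theorem extDeriv_familyForm {α : Fin m → ℝ} (hα : ∀ k, 0 < α k) {σ : V → Fin m → E3} {z : V}
    (hσ : ContDiffAt ℝ ∞ σ z) (hcl : ∀ᶠ y in nhds z, σ y ∈ closedPolygons α) :
    extDeriv (familyForm α σ) z = 0 := by
  have h : extDeriv (familyForm α σ) z = (extDeriv (fun v => productFormCLM α v)
      (σ z)).compContinuousLinearMap (fderiv ℝ σ z) :=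
    extDeriv_pullback (productFormCLM α).differentiableAt hσ (by
      rw [minSmoothness_of_isRCLikeNormedField]
      exact WithTop.coe_le_coe.2 (le_top : (2 : ℕ∞) ≤ ⊤))
  rw [h]
  ext w
  change extDeriv (fun v => productFormCLM α v) (σ z) (fun i => fderiv ℝ σ z (w i)) = 0
  rw [extDeriv_productFormCLM_apply]
  refine Finset.sum_eq_zero fun k _ => ?_
  have ht := fun a => (isTangent_of_hasFDerivAt
    (hσ.differentiableAt (by simp)).hasFDerivAt hcl a).1 k
  have hv : σ z k ≠ 0 := by
    have := hcl.self_of_nhds.1 k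
    intro h0
    rw [h0, norm_zero] at this
    exact (hα k).ne this
  rw [sphereForm_eq_zero_of_orthogonal hv (ht _) (ht _) (ht _), mul_zero]

/-- The derivatives of two families that differ by a variable rotation differ by that rotation and
an infinitesimal one. -/
theorem exists_infRot_of_rotate {A : V → Matrix (Fin 3) (Fin 3) ℝ} {σ τ : V → Fin m → E3} {z : V}
    {σ' τ' : V →L[ℝ] Fin m → E3} (hσ : HasFDerivAt σ σ' z) (hτ : HasFDerivAt τ τ' z)
    (hA : ∀ i j, DifferentiableAt ℝ (fun y => A y i j) z)
    (hAo : ∀ᶠ y in nhds z, A y ∈ Matrix.specialOrthogonalGroup (Fin 3) ℝ)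
    (h : ∀ᶠ y in nhds z, τ y = rotate (A y) (σ y)) (a : V) :
    ∃ κ, τ' a = rotate (A z) (σ' a) + infRot κ (rotate (A z) (σ z)) := by
  set A' : Fin 3 → Fin 3 → ℝ := fun i j => fderiv ℝ (fun y => A y i j) z a with hA'
  -- Derivative of $AA^{\mathsf T}=1$: the matrix $A'A^{\mathsf T}$ is skew.
  have horth : ∀ i j, A' i 0 * A z j 0 + A' i 1 * A z j 1 + A' i 2 * A z j 2 +
      (A' j 0 * A z i 0 + A' j 1 * A z i 1 + A' j 2 * A z i 2) = 0 := by
    intro i j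
    have d := fun i j => (hA i j).hasFDerivAt
    have h1 := (((d i 0).mul (d j 0)).add ((d i 1).mul (d j 1))).add ((d i 2).mul (d j 2))
    have h2 : ((((fun y => A y i 0) * fun y => A y j 0) + (fun y => A y i 1) * fun y => A y j 1) +
        (fun y => A y i 2) * fun y => A y j 2) =ᶠ[nhds z]
          fun _ => (1 : Matrix (Fin 3) (Fin 3) ℝ) i j := by
      filter_upwards [hAo] with y hy
      have := (Matrix.mem_orthogonalGroup_iff (Fin 3) ℝ).1
        (Matrix.mem_specialOrthogonalGroup_iff.1 hy).1
      rw [← this]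
      simp [Matrix.mul_apply, Fin.sum_univ_three]
    have h3 := DFunLike.congr_fun
      (h1.unique ((hasFDerivAt_const _ _).congr_of_eventuallyEq h2)) a
    simp at h3
    simp only [hA']
    linarith
  have hzo := hAo.self_of_nhds
  have hort : ∀ i j, A z 0 i * A z 0 j + A z 1 i * A z 1 j + A z 2 i * A z 2 j =
      (1 : Matrix (Fin 3) (Fin 3) ℝ) i j := by
    intro i j
    rw [← (Matrix.mem_orthogonalGroup_iff' (Fin 3) ℝ).1
      (Matrix.mem_specialOrthogonalGroup_iff.1 hzo).1]
    simp [Matrix.mul_apply, Fin.sum_univ_three]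
  set K : Fin 3 → Fin 3 → ℝ := fun i l =>
    A' i 0 * A z l 0 + A' i 1 * A z l 1 + A' i 2 * A z l 2 with hK
  have hKs : ∀ i j, K i j + K j i = 0 := horth
  -- Since $A^{\mathsf T}A=1$, the definition $K=A'A^{\mathsf T}$ gives $A'=KA$; the product rule
  -- then reads $\tau'=A\sigma'+K(A\sigma)$.
  have hAK : ∀ i j, A' i j = K i 0 * A z 0 j + K i 1 * A z 1 j + K i 2 * A z 2 j := by
    intro i j
    have h0 := hort 0 j; have h1 := hort 1 j; have h2 := hort 2 j
    have e : A' i j = A' i 0 * (1 : Matrix (Fin 3) (Fin 3) ℝ) 0 j +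
        A' i 1 * (1 : Matrix (Fin 3) (Fin 3) ℝ) 1 j +
        A' i 2 * (1 : Matrix (Fin 3) (Fin 3) ℝ) 2 j := by
      fin_cases j <;> simp [Matrix.one_apply]
    rw [e, ← h0, ← h1, ← h2]
    simp only [hK]
    ring
  have hder : ∀ k i, τ' a k i = act (A z) (σ' a k) i +
      (K i 0 * act (A z) (σ z k) 0 + K i 1 * act (A z) (σ z k) 1 +
        K i 2 * act (A z) (σ z k) 2) := by
    intro k i
    have dσ : ∀ k i, HasFDerivAt (fun y => σ y k i)
        ((EuclideanSpace.proj i : E3 →L[ℝ] ℝ).comp ((ContinuousLinearMap.proj k).comp σ')) z :=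
      fun k i => (EuclideanSpace.proj i : E3 →L[ℝ] ℝ).hasFDerivAt.comp z (hasFDerivAt_pi'.1 hσ k)
    have dτ : HasFDerivAt (fun y => τ y k i)
        ((EuclideanSpace.proj i : E3 →L[ℝ] ℝ).comp ((ContinuousLinearMap.proj k).comp τ')) z :=
      (EuclideanSpace.proj i : E3 →L[ℝ] ℝ).hasFDerivAt.comp z (hasFDerivAt_pi'.1 hτ k)
    have d := fun i j => (hA i j).hasFDerivAt
    have h1 := (((d i 0).mul (dσ k 0)).add ((d i 1).mul (dσ k 1))).add ((d i 2).mul (dσ k 2))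
    have h2 : (fun y => τ y k i) =ᶠ[nhds z]
        ((((fun y => A y i 0) * fun y => σ y k 0) + (fun y => A y i 1) * fun y => σ y k 1) +
          (fun y => A y i 2) * fun y => σ y k 2) := by
      filter_upwards [h] with y hy
      rw [hy]
      exact act_apply _ _ _
    have h3 := DFunLike.congr_fun (dτ.unique (h1.congr_of_eventuallyEq h2)) a
    simp at h3
    rw [h3, act_apply, act_apply, act_apply, act_apply]
    have e := hAK i
    simp only [hA'] at e
    rw [e 0, e 1, e 2]
    ring
  -- The axis of the skew matrix `K`: $Kx=\mu\times x$.
  obtain ⟨μ, hv0, hv1, hv2⟩ : ∃ μ : E3, μ 0 = K 2 1 ∧ μ 1 = K 0 2 ∧ μ 2 = K 1 0 :=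
    ⟨!₂[K 2 1, K 0 2, K 1 0], rfl, rfl, rfl⟩
  clear_value K
  refine ⟨μ, funext fun k => ?_⟩
  have k00 := hKs 0 0; have k11 := hKs 1 1; have k22 := hKs 2 2
  have k01 := hKs 0 1; have k02 := hKs 0 2; have k12 := hKs 1 2
  apply E3.ext_coords
  · rw [hder]
    simp only [Pi.add_apply, PiLp.add_apply, infRot, cross_zero_coord, rotate, hv1, hv2]
    linear_combination (act (A z) (σ z k) 0 / 2) * k00 + act (A z) (σ z k) 1 * k01
  · rw [hder]
    simp only [Pi.add_apply, PiLp.add_apply, infRot, cross_one_coord, rotate, hv0, hv2]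
    linear_combination (act (A z) (σ z k) 1 / 2) * k11 + act (A z) (σ z k) 2 * k12
  · rw [hder]
    simp only [Pi.add_apply, PiLp.add_apply, infRot, cross_two_coord, rotate, hv0, hv1]
    linear_combination (act (A z) (σ z k) 2 / 2) * k22 + act (A z) (σ z k) 0 * k02

end Families

/-! ### Oriented frames attached to two vectors -/

section Frames

theorem inner_cross_cross_self (x y : E3) :
    inner ℝ (cross x y) (cross x y) = inner ℝ x x * inner ℝ y y - inner ℝ x y ^ 2 := by
  simp only [inner_eq_coords, cross_zero_coord, cross_one_coord, cross_two_coord]; ring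

/-- The matrix with rows `f`, `g × f` and `g`. -/
noncomputable def rowsMatrix (f g : E3) : Matrix (Fin 3) (Fin 3) ℝ :=
  Matrix.of ![f.ofLp, (cross g f).ofLp, g.ofLp]

theorem act_rowsMatrix_zero (f g x : E3) : act (rowsMatrix f g) x 0 = inner ℝ f x := by
  rw [act_apply, inner_eq_coords]; rfl
theorem act_rowsMatrix_one (f g x : E3) : act (rowsMatrix f g) x 1 = inner ℝ (cross g f) x := by
  rw [act_apply, inner_eq_coords]; rfl
theorem act_rowsMatrix_two (f g x : E3) : act (rowsMatrix f g) x 2 = inner ℝ g x := by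
  rw [act_apply, inner_eq_coords]; rfl

theorem rowsMatrix_mem {f g : E3} (hf : inner ℝ f f = 1) (hg : inner ℝ g g = 1)
    (hfg : inner ℝ f g = 0) : rowsMatrix f g ∈ Matrix.specialOrthogonalGroup (Fin 3) ℝ := by
  rw [inner_eq_coords] at hf hg hfg
  rw [Matrix.mem_specialOrthogonalGroup_iff, Matrix.mem_orthogonalGroup_iff]
  have h0 : ∀ j, rowsMatrix f g 0 j = f j := fun _ => rfl
  have h1 : ∀ j, rowsMatrix f g 1 j = cross g f j := fun _ => rfl
  have h2 : ∀ j, rowsMatrix f g 2 j = g j := fun _ => rfl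
  constructor
  · suffices h : rowsMatrix f g * (rowsMatrix f g).transpose = 1 from h
    ext i j
    rw [Matrix.mul_apply, Fin.sum_univ_three]
    simp only [Matrix.transpose_apply]
    fin_cases i <;> fin_cases j <;>
      simp [h0, h1, h2]
    · linarith
    · ring
    · linarith
    · ring
    -- The squared norm of the middle row is $|f|^2|g|^2-\langle f,g\rangle^2$ by Lagrange's
    -- identity. The determinant below has the same value.
    · linear_combination (f 0 * f 0 + f 1 * f 1 + f 2 * f 2) * hg + hf -
        (f 0 * g 0 + f 1 * g 1 + f 2 * g 2) * hfg
    · ring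
    · linarith
    · ring
    · linarith
  · rw [Matrix.det_fin_three]
    simp only [h0, h1, h2, cross_zero_coord, cross_one_coord, cross_two_coord]
    linear_combination (f 0 * f 0 + f 1 * f 1 + f 2 * f 2) * hg + hf -
        (f 0 * g 0 + f 1 * g 1 + f 2 * g 2) * hfg

/-- The oriented orthonormal frame obtained from `p` and `q`, as the rows of a matrix. -/
noncomputable def frameMatrix (p q : E3) : Matrix (Fin 3) (Fin 3) ℝ :=
  rowsMatrix (‖p‖⁻¹ • p) (‖cross p q‖⁻¹ • cross p q)

theorem left_ne_zero_of_cross_ne_zero {p q : E3} (h : cross p q ≠ 0) : p ≠ 0 := by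
  rintro rfl
  exact h (E3.ext_coords (by simp) (by simp) (by simp))

theorem inner_inv_norm_smul_self {p : E3} (h : p ≠ 0) :
    inner ℝ (‖p‖⁻¹ • p) (‖p‖⁻¹ • p) = 1 := by
  have := norm_ne_zero_iff.2 h
  rw [inner_smul_left, inner_smul_right, real_inner_self_eq_norm_sq]
  simp
  field_simp

theorem inner_cross_left (p q : E3) : inner ℝ p (cross p q) = 0 := by
  simp only [inner_eq_coords, cross_zero_coord, cross_one_coord, cross_two_coord]; ring

theorem frameMatrix_mem {p q : E3} (h : cross p q ≠ 0) :
    frameMatrix p q ∈ Matrix.specialOrthogonalGroup (Fin 3) ℝ := by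
  refine rowsMatrix_mem (inner_inv_norm_smul_self (left_ne_zero_of_cross_ne_zero h))
    (inner_inv_norm_smul_self h) ?_
  rw [inner_smul_left, inner_smul_right, inner_cross_left]
  simp

theorem inner_eq_sphereForm_cross (p q x : E3) : inner ℝ (cross p q) x = sphereForm x p q := by
  simp only [inner_eq_coords, sphereForm_eq, cross_zero_coord, cross_one_coord, cross_two_coord]
  ring

theorem act_cross {A : Matrix (Fin 3) (Fin 3) ℝ}
    (hA : A ∈ Matrix.specialOrthogonalGroup (Fin 3) ℝ) (x y : E3) :
    cross (act A x) (act A y) = act A (cross x y) := by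
  refine ext_inner_right ℝ fun z => ?_
  -- Writing the test vector as an image under `A` turns the claim into the invariance of the triple
  -- product.
  have hz : act A (act A.transpose z) = z := by
    have := (Matrix.mem_orthogonalGroup_iff (Fin 3) ℝ).1
      (Matrix.mem_specialOrthogonalGroup_iff.1 hA).1
    have h2 := congrFun (rotate_mul (m := 1) A A.transpose fun _ => z) 0
    rw [show A * A.transpose = 1 from this, rotate_one] at h2
    exact h2.symm
  rw [← hz, inner_act hA, inner_eq_sphereForm_cross, inner_eq_sphereForm_cross,
    sphereForm_act hA]

theorem rowsMatrix_act {A : Matrix (Fin 3) (Fin 3) ℝ}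
    (hA : A ∈ Matrix.specialOrthogonalGroup (Fin 3) ℝ) (f g x : E3) :
    act (rowsMatrix (act A f) (act A g)) (act A x) = act (rowsMatrix f g) x := by
  apply E3.ext_coords
  · rw [act_rowsMatrix_zero, act_rowsMatrix_zero, inner_act hA]
  · rw [act_rowsMatrix_one, act_rowsMatrix_one, act_cross hA, inner_act hA]
  · rw [act_rowsMatrix_two, act_rowsMatrix_two, inner_act hA]

theorem act_smul (A : Matrix (Fin 3) (Fin 3) ℝ) (c : ℝ) (x : E3) : act A (c • x) = c • act A x :=
  map_smul _ _ _

/-- The frame rotates together with `p` and `q`, so the coordinates of a vector in it are rotation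
invariant. This makes normalization a function of the class. -/
theorem frameMatrix_act {A : Matrix (Fin 3) (Fin 3) ℝ}
    (hA : A ∈ Matrix.specialOrthogonalGroup (Fin 3) ℝ) (p q x : E3) :
    act (frameMatrix (act A p) (act A q)) (act A x) = act (frameMatrix p q) x := by
  rw [frameMatrix, norm_act hA, act_cross hA, norm_act hA, frameMatrix,
    ← rowsMatrix_act hA (‖p‖⁻¹ • p), act_smul, act_smul]

end Frames

/-! ### Normalized representatives -/

section Normalize

variable {m : ℕ}

/-- The rotated copy of `v` whose step `a` points along the first axis and whose step `b` lies in
the upper half of the plane of the first two axes. -/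
noncomputable def normalizePolygon (a b : Fin m) (v : Fin m → E3) : Fin m → E3 :=
  rotate (frameMatrix (v a) (v b)) v

/-- The conditions satisfied by normalized polygons. -/
structure IsNormalized (a b : Fin m) (w : Fin m → E3) : Prop where
  a1 : w a 1 = 0
  a2 : w a 2 = 0
  b2 : w b 2 = 0
  a0 : 0 < w a 0
  b1 : 0 < w b 1

theorem normalizePolygon_rotate {A : Matrix (Fin 3) (Fin 3) ℝ}
    (hA : A ∈ Matrix.specialOrthogonalGroup (Fin 3) ℝ) (a b : Fin m) (v : Fin m → E3) :
    normalizePolygon a b (rotate A v) = normalizePolygon a b v :=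
  funext fun _ => frameMatrix_act hA _ _ _

theorem isNormalized_normalizePolygon {a b : Fin m} {v : Fin m → E3} (h : cross (v a) (v b) ≠ 0) :
    IsNormalized a b (normalizePolygon a b v) := by
  have hp := left_ne_zero_of_cross_ne_zero h
  have hp' : 0 < ‖v a‖ := norm_pos_iff.2 hp
  have hs : 0 < ‖cross (v a) (v b)‖ := norm_pos_iff.2 h
  constructor
  · refine (act_rowsMatrix_one _ _ _).trans ?_
    simp only [inner_eq_coords, cross_zero_coord, cross_one_coord, cross_two_coord,
      PiLp.smul_apply, smul_eq_mul]
    ring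
  · refine (act_rowsMatrix_two _ _ _).trans ?_
    simp only [inner_eq_coords, cross_zero_coord, cross_one_coord, cross_two_coord,
      PiLp.smul_apply, smul_eq_mul]
    ring
  · refine (act_rowsMatrix_two _ _ _).trans ?_
    simp only [inner_eq_coords, cross_zero_coord, cross_one_coord, cross_two_coord,
      PiLp.smul_apply, smul_eq_mul]
    ring
  · refine lt_of_lt_of_eq ?_ (act_rowsMatrix_zero _ _ _).symm
    rw [inner_smul_left, real_inner_self_eq_norm_sq]
    simp only [map_inv₀, conj_trivial]
    positivity
  · refine lt_of_lt_of_eq ?_ (act_rowsMatrix_one _ _ _).symm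
    -- With $n=p\times q$, the identity $\langle n\times p,q\rangle=\langle n,p\times q\rangle$
    -- shows that this coordinate is $|p\times q|/|p|$.
    have : inner ℝ (cross (‖cross (v a) (v b)‖⁻¹ • cross (v a) (v b)) (‖v a‖⁻¹ • v a)) (v b) =
        ‖cross (v a) (v b)‖⁻¹ * ‖v a‖⁻¹ * inner ℝ (cross (v a) (v b)) (cross (v a) (v b)) := by
      simp only [inner_eq_coords, cross_zero_coord, cross_one_coord, cross_two_coord,
        PiLp.smul_apply, smul_eq_mul]
      ring
    rw [this, real_inner_self_eq_norm_sq]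
    positivity

/-- For parallel steps the inverse norm takes its default value 0 and the last two rows of the frame
matrix vanish. Positivity of this one coordinate therefore recognizes the polygons for which the
frame is genuine. -/
theorem cross_ne_zero_of_normalizePolygon_pos {a b : Fin m} {v : Fin m → E3}
    (h : 0 < normalizePolygon a b v b 1) : cross (v a) (v b) ≠ 0 := by
  intro h0
  have h1 : normalizePolygon a b v b 1 = _ := act_rowsMatrix_one _ _ _
  rw [h1, h0] at h
  simp [inner_eq_coords] at h

theorem norm_eq_of_coords {x : E3} {r : ℝ} (hr : 0 ≤ r)
    (h : x 0 * x 0 + x 1 * x 1 + x 2 * x 2 = r * r) : ‖x‖ = r := by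
  rw [norm_eq_sqrt_real_inner, inner_eq_coords, h, Real.sqrt_mul_self hr]

theorem IsNormalized.frameMatrix_eq_one {a b : Fin m} {w : Fin m → E3} (h : IsNormalized a b w) :
    frameMatrix (w a) (w b) = 1 := by
  have h0 := h.a0.ne'
  have h1 := h.b1.ne'
  have hp : ‖w a‖ = w a 0 := norm_eq_of_coords h.a0.le (by rw [h.a1, h.a2]; ring)
  have hc : ‖cross (w a) (w b)‖ = w a 0 * w b 1 :=
    norm_eq_of_coords (mul_pos h.a0 h.b1).le (by simp [h.a1, h.a2, h.b2])
  rw [frameMatrix, hp, hc]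
  ext i j
  fin_cases i <;> fin_cases j <;> simp [rowsMatrix, h.a1, h.a2, h.b2] <;>
    field_simp

theorem IsNormalized.normalizePolygon_eq {a b : Fin m} {w : Fin m → E3} (h : IsNormalized a b w) :
    normalizePolygon a b w = w := by
  rw [normalizePolygon, h.frameMatrix_eq_one, rotate_one]

theorem contDiff_cross : ContDiff ℝ ∞ fun x : E3 × E3 => cross x.1 x.2 := by
  rw [contDiff_euclidean]
  have e : ∀ i : Fin 3, ContDiff ℝ ∞ fun x : E3 => x i := fun i =>
    (EuclideanSpace.proj i : E3 →L[ℝ] ℝ).contDiff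
  have e1 : ∀ i : Fin 3, ContDiff ℝ ∞ fun x : E3 × E3 => x.1 i := fun i => (e i).comp contDiff_fst
  have e2 : ∀ i : Fin 3, ContDiff ℝ ∞ fun x : E3 × E3 => x.2 i := fun i => (e i).comp contDiff_snd
  intro i
  fin_cases i
  · simpa using ((e1 1).mul (e2 2)).sub ((e1 2).mul (e2 1))
  · simpa using ((e1 2).mul (e2 0)).sub ((e1 0).mul (e2 2))
  · simpa using ((e1 0).mul (e2 1)).sub ((e1 1).mul (e2 0))

theorem contDiffAt_frameMatrix {a b : Fin m} {v : Fin m → E3} (h : cross (v a) (v b) ≠ 0)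
    (i j : Fin 3) :
    ContDiffAt ℝ ∞ (fun v : Fin m → E3 => frameMatrix (v a) (v b) i j) v := by
  have ea : ContDiffAt ℝ ∞ (fun v : Fin m → E3 => v a) v := (contDiff_apply ℝ E3 a).contDiffAt
  have eb : ContDiffAt ℝ ∞ (fun v : Fin m → E3 => v b) v := (contDiff_apply ℝ E3 b).contDiffAt
  have ec : ContDiffAt ℝ ∞ (fun v : Fin m → E3 => cross (v a) (v b)) v :=
    contDiff_cross.contDiffAt.comp v (ea.prodMk eb)
  have hf : ContDiffAt ℝ ∞ (fun v : Fin m → E3 => ‖v a‖⁻¹ • v a) v := by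
    refine ContDiffAt.smul (ContDiffAt.inv (ea.norm ℝ ?_) ?_) ea
    · exact left_ne_zero_of_cross_ne_zero h
    · exact norm_ne_zero_iff.2 (left_ne_zero_of_cross_ne_zero h)
  have hg : ContDiffAt ℝ ∞
      (fun v : Fin m → E3 => ‖cross (v a) (v b)‖⁻¹ • cross (v a) (v b)) v :=
    ContDiffAt.smul (ContDiffAt.inv (ec.norm ℝ h) (norm_ne_zero_iff.2 h)) ec
  have hgf := contDiff_cross.contDiffAt.comp v (hg.prodMk hf)
  have e : ∀ i : Fin 3, ContDiff ℝ ∞ fun x : E3 => x i := fun i =>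
    (EuclideanSpace.proj i : E3 →L[ℝ] ℝ).contDiff
  fin_cases i
  · exact (e j).contDiffAt.comp v hf
  · exact (e j).contDiffAt.comp v hgf
  · exact (e j).contDiffAt.comp v hg

theorem contDiffAt_normalizePolygon {a b : Fin m} {v : Fin m → E3} (h : cross (v a) (v b) ≠ 0) :
    ContDiffAt ℝ ∞ (normalizePolygon a b) v := by
  rw [contDiffAt_pi]
  intro k
  rw [contDiffAt_euclidean]
  intro i
  have e : ∀ j : Fin 3, ContDiffAt ℝ ∞ (fun v : Fin m → E3 => v k j) v := fun j =>
    ((EuclideanSpace.proj j : E3 →L[ℝ] ℝ).contDiff.comp (contDiff_apply ℝ E3 k)).contDiffAt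
  have hm := contDiffAt_frameMatrix h i
  refine ((((hm 0).mul (e 0)).add ((hm 1).mul (e 1))).add ((hm 2).mul (e 2))).congr_of_eventuallyEq
    (Filter.Eventually.of_forall fun w => ?_)
  exact act_apply _ _ _

theorem isOpen_cross_ne_zero (a b : Fin m) : IsOpen {v : Fin m → E3 | cross (v a) (v b) ≠ 0} := by
  have : Continuous fun v : Fin m → E3 => cross (v a) (v b) :=
    contDiff_cross.continuous.comp (by fun_prop : Continuous fun v : Fin m → E3 => (v a, v b))
  exact isOpen_ne_fun this continuous_const

/-- A polygon with all steps parallel lies on a line, and its closing condition is a vanishing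
signed sum of the lengths. The construction of the charts and of the reduced form uses genericity
only through this fact. -/
theorem exists_cross_ne_zero {α : Fin m → ℝ} (hα : ∀ k, 0 < α k) (hgen : IsGeneric α)
    {v : Fin m → E3} (hv : v ∈ closedPolygons α) : ∃ a b, cross (v a) (v b) ≠ 0 := by
  by_contra! hall
  rcases Nat.eq_zero_or_pos m with rfl | hm
  · exact hgen (fun _ => 1) (fun k => k.elim0) (by simp)
  let a : Fin m := ⟨0, hm⟩
  -- The signs are the cosines of the angles with step `a`; Lagrange's identity makes their squares
  -- equal to 1.
  refine hgen (fun k => inner ℝ (v a) (v k) / (α a * α k)) (fun k => ?_) ?_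
  · have h1 := inner_cross_cross_self (v a) (v k)
    rw [hall a k, inner_zero_left, real_inner_self_eq_norm_sq, real_inner_self_eq_norm_sq, hv.1,
      hv.1] at h1
    have h2 := (hα a).ne'
    have h3 := (hα k).ne'
    refine mul_self_eq_one_iff.1 ?_
    rw [← sq, div_pow, div_eq_one_iff_eq (by positivity)]
    linarith
  · have : ∀ k, inner ℝ (v a) (v k) / (α a * α k) * α k = (α a)⁻¹ * inner ℝ (v a) (v k) := by
      intro k
      have h2 := (hα a).ne'
      have h3 := (hα k).ne'
      field_simp
    simp only [this, ← Finset.mul_sum, ← inner_sum, hv.2, inner_zero_right, mul_zero]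

end Normalize

/-! ### The slice of normalized closed polygons -/

section Slices

variable {m : ℕ}

/-- The target of the map whose level sets are the normalized closed polygons. -/
abbrev ConstraintSpace (m : ℕ) := (Fin m → ℝ) × E3 × (Fin 3 → ℝ)

/-- The coordinate `i` of step `k`, as a linear functional. -/
noncomputable def coordCLM (k : Fin m) (i : Fin 3) : (Fin m → E3) →L[ℝ] ℝ :=
  (EuclideanSpace.proj i : E3 →L[ℝ] ℝ).comp (ContinuousLinearMap.proj k)

/-- The squared lengths, the sum of the steps, and the normalization conditions. -/
noncomputable def constraintMap (a b : Fin m) (v : Fin m → E3) : ConstraintSpace m :=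
  (fun k => inner ℝ (v k) (v k), ∑ k, v k, ![v a 1, v a 2, v b 2])

/-- The derivative of `constraintMap`. -/
noncomputable def constraintDeriv (a b : Fin m) (w : Fin m → E3) :
    (Fin m → E3) →L[ℝ] ConstraintSpace m :=
  (ContinuousLinearMap.pi fun k => (2 : ℝ) • (innerSL ℝ (w k)).comp (ContinuousLinearMap.proj k)).prod
    ((∑ k, ContinuousLinearMap.proj k).prod
      (ContinuousLinearMap.pi ![coordCLM a 1, coordCLM a 2, coordCLM b 2]))

theorem constraintDeriv_apply (a b : Fin m) (w x : Fin m → E3) : constraintDeriv a b w x =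
    (fun k => 2 * inner ℝ (w k) (x k), ∑ k, x k, ![x a 1, x a 2, x b 2]) := by
  refine Prod.ext (funext fun k => ?_) (Prod.ext ?_ (funext fun i => ?_))
  · simp [constraintDeriv]
  · simp [constraintDeriv]
  · fin_cases i <;> rfl

theorem contDiff_constraintMap (a b : Fin m) : ContDiff ℝ ∞ (constraintMap a b) := by
  have h : ∀ k, ContDiff ℝ ∞ fun v : Fin m → E3 => v k := fun k => contDiff_apply ℝ E3 k
  refine ContDiff.prodMk (contDiff_pi.2 fun k => (h k).inner ℝ (h k))
    (ContDiff.prodMk (ContDiff.sum fun k _ => h k) (contDiff_pi.2 fun i => ?_))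
  fin_cases i
  · exact (coordCLM a 1).contDiff
  · exact (coordCLM a 2).contDiff
  · exact (coordCLM b 2).contDiff

theorem hasFDerivAt_constraintMap (a b : Fin m) (w : Fin m → E3) :
    HasFDerivAt (constraintMap a b) (constraintDeriv a b w) w := by
  have h : ∀ k, HasFDerivAt (fun v : Fin m → E3 => v k)
      (ContinuousLinearMap.proj k : (Fin m → E3) →L[ℝ] E3) w := fun k =>
    (ContinuousLinearMap.proj k : (Fin m → E3) →L[ℝ] E3).hasFDerivAt
  refine HasFDerivAt.prodMk (hasFDerivAt_pi.2 fun k => ?_)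
    (HasFDerivAt.prodMk (HasFDerivAt.fun_sum fun k _ => h k) (hasFDerivAt_pi.2 fun i => ?_))
  · refine ((h k).inner ℝ (h k)).congr_fderiv ?_
    ext x
    simp [real_inner_comm (w k), two_mul]
  · fin_cases i
    · exact (coordCLM a 1).hasFDerivAt
    · exact (coordCLM a 2).hasFDerivAt
    · exact (coordCLM b 2).hasFDerivAt

theorem IsNormalized.ne {a b : Fin m} {w : Fin m → E3} (h : IsNormalized a b w) : a ≠ b := by
  rintro rfl
  exact h.b1.ne' h.a1

/-- Infinitesimal rotations act simply transitively on the normalization conditions. -/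
theorem IsNormalized.exists_infRot {a b : Fin m} {w : Fin m → E3} (h : IsNormalized a b w)
    (g : Fin 3 → ℝ) :
    ∃ κ, infRot κ w a 1 = g 0 ∧ infRot κ w a 2 = g 1 ∧ infRot κ w b 2 = g 2 := by
  have h0 := h.a0.ne'
  have h1 := h.b1.ne'
  obtain ⟨κ, k0, k1, k2⟩ : ∃ κ : E3, κ 0 = (g 2 - g 1 / w a 0 * w b 0) / w b 1 ∧
      κ 1 = -g 1 / w a 0 ∧ κ 2 = g 0 / w a 0 := ⟨!₂[_, _, _], rfl, rfl, rfl⟩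
  refine ⟨κ, ?_, ?_, ?_⟩ <;>
    (simp [infRot, h.a1, h.a2, k0, k1, k2]; field_simp; try ring)

theorem IsNormalized.infRot_eq_zero {a b : Fin m} {w : Fin m → E3} (h : IsNormalized a b w)
    {κ : E3} (h1 : infRot κ w a 1 = 0) (h2 : infRot κ w a 2 = 0) (h3 : infRot κ w b 2 = 0) :
    κ = 0 := by
  simp [infRot, h.a1, h.a2, h.a0.ne'] at h1 h2 h3
  simp [h2, h.b1.ne'] at h3
  exact E3.ext_coords h3 h2 h1

/-- The tangent planes of the spheres at two independent steps span $\mathbb R^3$, so moving only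
steps `a` and `b` achieves any change of the sum. -/
theorem IsNormalized.exists_isTangent_sum {a b : Fin m} {w : Fin m → E3} (h : IsNormalized a b w)
    (t : E3) : ∃ y : Fin m → E3, (∀ k, inner ℝ (w k) (y k) = 0) ∧ ∑ k, y k = t := by
  have h0 := h.a0.ne'
  have h1 := h.b1.ne'
  have hab := h.ne
  -- Step `a` is along the first axis, so `p` has no first coordinate and `q` must supply `t 0`.
  -- Orthogonality of `q` to step `b` then forces `q 1`, which `p 1` compensates.
  obtain ⟨p, p0, p1, p2⟩ : ∃ p : E3, p 0 = 0 ∧ p 1 = t 1 + t 0 * w b 0 / w b 1 ∧ p 2 = t 2 :=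
    ⟨!₂[_, _, _], rfl, rfl, rfl⟩
  obtain ⟨q, q0, q1, q2⟩ : ∃ q : E3, q 0 = t 0 ∧ q 1 = -(t 0 * w b 0 / w b 1) ∧ q 2 = 0 :=
    ⟨!₂[_, _, _], rfl, rfl, rfl⟩
  refine ⟨Pi.single a p + Pi.single b q, fun k => ?_, ?_⟩
  · by_cases hka : k = a
    · subst hka
      simp [inner_eq_coords, hab, p0, p1, p2, h.a1, h.a2]
    · by_cases hkb : k = b
      · subst hkb
        simp [inner_eq_coords, hka, q0, q1, q2]
        field_simp
        ring
      · simp [hka, hkb]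
  · simp only [Pi.add_apply, Finset.sum_add_distrib]
    apply E3.ext_coords <;> simp [p0, p1, p2, q0, q1, q2]

/-- The three blocks are solved in order, each without disturbing the earlier ones: a radial
variation adjusts the lengths, a variation tangent to the spheres the sum, and an infinitesimal
rotation the normalization. -/
theorem constraintDeriv_surjective {α : Fin m → ℝ} (hα : ∀ k, 0 < α k) {a b : Fin m}
    {w : Fin m → E3} (hw : w ∈ closedPolygons α) (hn : IsNormalized a b w) :
    Function.Surjective (constraintDeriv a b w) := by
  rintro ⟨r, s, g⟩
  set x0 : Fin m → E3 := fun k => (r k / (2 * α k ^ 2)) • w k with hx0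
  obtain ⟨y, hy, hys⟩ := hn.exists_isTangent_sum (s - ∑ k, x0 k)
  obtain ⟨κ, h1, h2, h3⟩ := hn.exists_infRot
    ![g 0 - (x0 + y) a 1, g 1 - (x0 + y) a 2, g 2 - (x0 + y) b 2]
  have ht := isTangent_infRot hw.2 κ
  refine ⟨x0 + y + infRot κ w, ?_⟩
  rw [constraintDeriv_apply]
  refine Prod.ext (funext fun k => ?_) (Prod.ext ?_ (funext fun i => ?_))
  · have := (hα k).ne'
    simp only [Pi.add_apply, inner_add_right, hy k, ht.1 k, hx0, inner_smul_right,
      real_inner_self_eq_norm_sq, hw.1 k]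
    field_simp
    ring
  · simp [Finset.sum_add_distrib, hys, ht.2]
  · fin_cases i
    · simp at h1 ⊢
      rw [h1]; ring
    · simp at h2 ⊢
      rw [h2]; ring
    · simp at h3 ⊢
      rw [h3]; ring

theorem finrank_ker_constraintDeriv {α : Fin m → ℝ} (hα : ∀ k, 0 < α k) {a b : Fin m}
    {w : Fin m → E3} (hw : w ∈ closedPolygons α) (hn : IsNormalized a b w) :
    Module.finrank ℝ (LinearMap.ker (constraintDeriv a b w).toLinearMap) = 2 * (m - 3) := by
  have h := LinearMap.finrank_range_add_finrank_ker (constraintDeriv a b w).toLinearMap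
  rw [LinearMap.range_eq_top.2 (constraintDeriv_surjective hα hw hn), finrank_top,
    Module.finrank_prod, Module.finrank_prod, Module.finrank_pi, Module.finrank_pi,
    Module.finrank_pi_fintype] at h
  simp at h
  -- The rank equation $m+6+\dim\ker=3m$ itself forces $m\ge 3$, so the truncated subtraction is
  -- harmless.
  omega

theorem mem_closedPolygons_of_constraintMap_eq {α : Fin m → ℝ} (hα : ∀ k, 0 < α k) {a b : Fin m}
    {v w : Fin m → E3} (hw : w ∈ closedPolygons α) (h : constraintMap a b v = constraintMap a b w) :
    v ∈ closedPolygons α := by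
  refine ⟨fun k => ?_, ?_⟩
  · have h1 : inner ℝ (v k) (v k) = inner ℝ (w k) (w k) := congrFun (congrArg Prod.fst h) k
    rw [real_inner_self_eq_norm_sq, real_inner_self_eq_norm_sq, hw.1 k] at h1
    exact (sq_eq_sq₀ (norm_nonneg _) (hα k).le).1 h1
  · have h1 : ∑ k, v k = ∑ k, w k := congrArg (fun x => x.2.1) h
    rw [h1, hw.2]

theorem isNormalized_of_constraintMap_eq {a b : Fin m} {v w : Fin m → E3}
    (hw : IsNormalized a b w) (h : constraintMap a b v = constraintMap a b w)
    (h0 : 0 < v a 0) (h1 : 0 < v b 1) : IsNormalized a b v := by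
  have h2 : ∀ i : Fin 3, (constraintMap a b v).2.2 i = (constraintMap a b w).2.2 i := by simp [h]
  exact ⟨(h2 0).trans hw.a1, (h2 1).trans hw.a2, (h2 2).trans hw.b2, h0, h1⟩

theorem constraintMap_eq {α : Fin m → ℝ} {a b : Fin m} {v w : Fin m → E3}
    (hv : v ∈ closedPolygons α) (hw : w ∈ closedPolygons α) (hvn : IsNormalized a b v)
    (hwn : IsNormalized a b w) : constraintMap a b v = constraintMap a b w := by
  refine Prod.ext (funext fun k => ?_) (Prod.ext (hv.2.trans hw.2.symm) (funext fun i => ?_))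
  · simp only [constraintMap, real_inner_self_eq_norm_sq, hv.1 k, hw.1 k]
  · simp only [constraintMap, hvn.a1, hvn.a2, hvn.b2, hwn.a1, hwn.a2, hwn.b2]

/-- Local coordinates of `(ℝ³)ᵐ` near a normalized closed polygon that straighten the constraints. -/
theorem exists_slice_coordinates {α : Fin m → ℝ} (hα : ∀ k, 0 < α k) {a b : Fin m}
    {w : Fin m → E3} (hw : w ∈ closedPolygons α) (hn : IsNormalized a b w) :
    ∃ (T : (Fin m → E3) →L[ℝ] EuclideanSpace ℝ (Fin (2 * (m - 3))))
      (Ψ : OpenPartialHomeomorph (Fin m → E3)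
        (ConstraintSpace m × EuclideanSpace ℝ (Fin (2 * (m - 3))))),
      w ∈ Ψ.source ∧ (∀ v, Ψ v = (constraintMap a b v, T v)) ∧
      ContDiffOn ℝ ∞ Ψ.symm Ψ.target ∧ ∀ v ∈ Ψ.source, 0 < v a 0 ∧ 0 < v b 1 := by
  -- A linear projection onto the kernel of the constraints; its coordinates complete the
  -- constraints to a local coordinate system.
  obtain ⟨T0, hT0⟩ := LinearMap.exists_leftInverse_of_injective
    (LinearMap.ker (constraintDeriv a b w).toLinearMap).subtype (by simp)
  let e : LinearMap.ker (constraintDeriv a b w).toLinearMap ≃ₗ[ℝ]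
      EuclideanSpace ℝ (Fin (2 * (m - 3))) :=
    LinearEquiv.ofFinrankEq _ _ (by rw [finrank_ker_constraintDeriv hα hw hn]; simp)
  let T : (Fin m → E3) →L[ℝ] EuclideanSpace ℝ (Fin (2 * (m - 3))) :=
    LinearMap.toContinuousLinearMap (e.toLinearMap ∘ₗ T0)
  have hbij : Function.Bijective ((constraintDeriv a b w).prod T) := by
    constructor
    · rw [injective_iff_map_eq_zero]
      intro x hx
      have hx1 : constraintDeriv a b w x = 0 := congrArg Prod.fst hx
      have hx2 : e (T0 x) = 0 := congrArg Prod.snd hx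
      have hx3 : T0 x = 0 := by simpa using hx2
      have hx4 := LinearMap.congr_fun hT0 ⟨x, hx1⟩
      have hx5 : T0 x = ⟨x, hx1⟩ := hx4
      rw [hx3] at hx5
      exact (congrArg Subtype.val hx5).symm
    · rintro ⟨c, y⟩
      obtain ⟨x, rfl⟩ := constraintDeriv_surjective hα hw hn c
      set z := e.symm (y - T x)
      have hz : constraintDeriv a b w z.1 = 0 := z.2
      have hT : T z.1 = y - T x := by
        have h4 : T0 z.1 = z := LinearMap.congr_fun hT0 z
        change e (T0 z.1) = _
        rw [h4]
        exact e.apply_symm_apply _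
      exact ⟨x + z.1, by simp [hz, hT]⟩
  let f : (Fin m → E3) → ConstraintSpace m × EuclideanSpace ℝ (Fin (2 * (m - 3))) :=
    fun v => (constraintMap a b v, T v)
  have hf : ContDiff ℝ ∞ f := (contDiff_constraintMap a b).prodMk T.contDiff
  let E : (Fin m → E3) ≃L[ℝ] ConstraintSpace m × EuclideanSpace ℝ (Fin (2 * (m - 3))) :=
    (LinearEquiv.ofBijective ((constraintDeriv a b w).prod T).toLinearMap
      hbij).toContinuousLinearEquiv
  have hfE : HasFDerivAt f (E : (Fin m → E3) →L[ℝ] _) w :=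
    (hasFDerivAt_constraintMap a b w).prodMk T.hasFDerivAt
  let Φ := hf.contDiffAt.toOpenPartialHomeomorph f hfE (by simp)
  -- Restricting to points with invertible derivative makes the inverse smooth on the whole target.
  -- The two sign conditions keep the level set inside the normalized polygons.
  let O : Set (Fin m → E3) := (fderiv ℝ f ⁻¹' Set.range ((↑) : ((Fin m → E3) ≃L[ℝ]
    ConstraintSpace m × EuclideanSpace ℝ (Fin (2 * (m - 3)))) → (Fin m → E3) →L[ℝ] _)) ∩
      {v | 0 < coordCLM a 0 v ∧ 0 < coordCLM b 1 v}
  have hO : IsOpen O :=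
    (ContinuousLinearEquiv.isOpen.preimage (hf.continuous_fderiv (by simp))).inter
      ((isOpen_lt continuous_const (coordCLM a 0).continuous).inter
        (isOpen_lt continuous_const (coordCLM b 1).continuous))
  refine ⟨T, Φ.restrOpen O hO, ?_, fun v => rfl, ?_, ?_⟩
  · refine ⟨hf.contDiffAt.mem_toOpenPartialHomeomorph_source hfE (by simp), ⟨E, ?_⟩, hn.a0, hn.b1⟩
    exact hfE.fderiv.symm
  · intro y hy
    have hy2 : (Φ.restrOpen O hO).symm y ∈ O := ((Φ.restrOpen O hO).map_target hy).2
    obtain ⟨E', hE'⟩ := hy2.1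
    refine ((Φ.restrOpen O hO).contDiffAt_symm (f₀' := E') hy ?_ hf.contDiffAt).contDiffWithinAt
    rw [hE']
    exact (hf.differentiable (by simp) _).hasFDerivAt
  · intro v hv
    exact hv.2.2

end Slices

/-! ### Charts of the polygon space -/

section Charts

variable {m : ℕ} {α : Fin m → ℝ}

theorem PolygonSpace.mk_eq_mk {v w : closedPolygons α} :
    PolygonSpace.mk v = PolygonSpace.mk w ↔
      ∃ A ∈ Matrix.specialOrthogonalGroup (Fin 3) ℝ, rotate A v.1 = w.1 :=
  Quotient.eq

theorem continuous_rotate (A : Matrix (Fin 3) (Fin 3) ℝ) :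
    Continuous (rotate A : (Fin m → E3) → Fin m → E3) :=
  continuous_pi fun k =>
    (LinearMap.continuous_of_finiteDimensional (Matrix.toEuclideanLin A)).comp (continuous_apply k)

/-- The saturation of an open set is the union of its rotated copies. -/
theorem PolygonSpace.isOpenQuotientMap_mk :
    IsOpenQuotientMap (PolygonSpace.mk : closedPolygons α → PolygonSpace α) := by
  refine ⟨Quotient.mk_surjective, continuous_quotient_mk', fun U hU => ?_⟩
  have : PolygonSpace.mk ⁻¹' (PolygonSpace.mk '' U) =
      ⋃ A : Matrix.specialOrthogonalGroup (Fin 3) ℝ,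
        (fun v : closedPolygons α =>
          (⟨rotate A.1 v.1, rotate_mem_closedPolygons A.2 v.2⟩ : closedPolygons α)) ⁻¹' U := by
    ext v
    simp only [Set.mem_preimage, Set.mem_image, Set.mem_iUnion]
    constructor
    · rintro ⟨w, hw, h⟩
      obtain ⟨A, hA, h'⟩ := PolygonSpace.mk_eq_mk.1 h.symm
      refine ⟨⟨A, hA⟩, ?_⟩
      convert hw using 1
      exact Subtype.ext h'
    · rintro ⟨A, hA⟩
      exact ⟨_, hA, (PolygonSpace.mk_eq_mk.2 ⟨A.1, A.2, rfl⟩).symm⟩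
  refine isOpen_coinduced.2 ?_
  change IsOpen (PolygonSpace.mk ⁻¹' (PolygonSpace.mk '' U))
  rw [this]
  refine isOpen_iUnion fun A => hU.preimage ?_
  exact ((continuous_rotate A.1).comp continuous_subtype_val).subtype_mk _

theorem normalizePolygon_mem {a b : Fin m} {v : Fin m → E3} (hv : v ∈ closedPolygons α)
    (h : cross (v a) (v b) ≠ 0) : normalizePolygon a b v ∈ closedPolygons α :=
  rotate_mem_closedPolygons (frameMatrix_mem h) hv

theorem mk_normalizePolygon {a b : Fin m} {v : Fin m → E3} (hv : v ∈ closedPolygons α)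
    (h : cross (v a) (v b) ≠ 0) :
    PolygonSpace.mk ⟨normalizePolygon a b v, normalizePolygon_mem hv h⟩ =
      PolygonSpace.mk ⟨v, hv⟩ :=
  (PolygonSpace.mk_eq_mk.2 ⟨_, frameMatrix_mem h, rfl⟩).symm

/-- The normalized representative of a class of polygons. -/
noncomputable def normalizedRep (a b : Fin m) : PolygonSpace α → Fin m → E3 :=
  Quotient.lift (fun v => normalizePolygon a b v.1) (by
    rintro v w ⟨A, hA, h⟩
    rw [← h, normalizePolygon_rotate hA])

theorem continuousAt_normalizedRep {a b : Fin m} {x : PolygonSpace α}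
    (hx : 0 < normalizedRep a b x b 1) : ContinuousAt (normalizedRep a b) x := by
  induction x using Quotient.inductionOn with
  | h v =>
    have h := cross_ne_zero_of_normalizePolygon_pos hx
    refine (PolygonSpace.isOpenQuotientMap_mk.continuousAt_comp_iff (x := v)).1 ?_
    exact (contDiffAt_normalizePolygon h).continuousAt.comp continuous_subtype_val.continuousAt

/-- `normalizedRep` is defined on all classes, with meaningless values when the two steps are
parallel. Positivity on `S` confines the preimage to points of continuity. -/
theorem isOpen_preimage_normalizedRep {a b : Fin m} {S : Set (Fin m → E3)} (hS : IsOpen S)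
    (hpos : ∀ v ∈ S, 0 < v b 1) : IsOpen (normalizedRep (α := α) a b ⁻¹' S) := by
  refine isOpen_iff_mem_nhds.2 fun x hx => ?_
  exact (continuousAt_normalizedRep (hpos _ hx)).preimage_mem_nhds (hS.mem_nhds hx)

/-- In the straightening coordinates the slice is the set where the constraints equal `c`. The chart
takes the remaining coordinates of the normalized representative; its inverse fixes the constraints
at `c` and solves for the polygon. -/
theorem exists_isPolygonChart (hα : ∀ k, 0 < α k) {a b : Fin m} {w : Fin m → E3}
    (hw : w ∈ closedPolygons α) (hn : IsNormalized a b w) :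
    ∃ φ, IsPolygonChart α φ ∧ PolygonSpace.mk ⟨w, hw⟩ ∈ φ.source := by
  classical
  obtain ⟨T, Ψ, hwΨ, hΨ, hsymm, hpos⟩ := exists_slice_coordinates hα hw hn
  set c := constraintMap a b w with hc
  let σ : EuclideanSpace ℝ (Fin (2 * (m - 3))) → Fin m → E3 := fun z => Ψ.symm (c, z)
  let S : Set (PolygonSpace α) := normalizedRep a b ⁻¹' Ψ.source
  let R : Set (EuclideanSpace ℝ (Fin (2 * (m - 3)))) := (fun z => (c, z)) ⁻¹' Ψ.target
  have hR : IsOpen R := Ψ.open_target.preimage (by fun_prop)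
  have hσs : ∀ z ∈ R, σ z ∈ Ψ.source := fun z hz => Ψ.map_target hz
  have hσc : ∀ z ∈ R, constraintMap a b (σ z) = c ∧ T (σ z) = z := fun z hz => by
    have h1 := Ψ.right_inv hz
    rw [hΨ] at h1
    exact ⟨congrArg Prod.fst h1, congrArg Prod.snd h1⟩
  have hσm : ∀ z ∈ R, σ z ∈ closedPolygons α := fun z hz =>
    mem_closedPolygons_of_constraintMap_eq hα hw (hσc z hz).1
  have hσn : ∀ z ∈ R, IsNormalized a b (σ z) := fun z hz =>
    isNormalized_of_constraintMap_eq hn (hσc z hz).1 (hpos _ (hσs z hz)).1 (hpos _ (hσs z hz)).2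
  have hσd : ContDiffOn ℝ ∞ σ R :=
    hsymm.comp (t := Ψ.target) (contDiff_const.prodMk contDiff_id).contDiffOn fun z hz => hz
  -- The class of `w` is only a default value: on `R` the first branch always applies.
  let inv : EuclideanSpace ℝ (Fin (2 * (m - 3))) → PolygonSpace α := fun z =>
    if h : σ z ∈ closedPolygons α then PolygonSpace.mk ⟨σ z, h⟩ else PolygonSpace.mk ⟨w, hw⟩
  have hinv : ∀ z (h : z ∈ R), inv z = PolygonSpace.mk ⟨σ z, hσm z h⟩ := fun z h =>
    dif_pos (hσm z h)
  have hrep : ∀ z ∈ R, normalizedRep a b (inv z) = σ z := fun z h => by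
    rw [hinv z h]
    exact (hσn z h).normalizePolygon_eq
  have hΨrep : ∀ x ∈ S, Ψ (normalizedRep a b x) = (c, T (normalizedRep a b x)) := by
    intro x hx
    induction x using Quotient.inductionOn with
    | h v =>
      have hcr := cross_ne_zero_of_normalizePolygon_pos (hpos _ hx).2
      rw [hΨ]
      exact Prod.ext (constraintMap_eq (normalizePolygon_mem v.2 hcr) hw
        (isNormalized_normalizePolygon hcr) hn) rfl
  have hleft : ∀ x ∈ S, σ (T (normalizedRep a b x)) = normalizedRep a b x := fun x hx => by
    change Ψ.symm _ = _
    rw [← hΨrep x hx, Ψ.left_inv hx]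
  let φ : OpenPartialHomeomorph (PolygonSpace α) (EuclideanSpace ℝ (Fin (2 * (m - 3)))) :=
    { toFun := fun x => T (normalizedRep a b x)
      invFun := inv
      source := S
      target := R
      map_source' := fun x hx => by
        change (c, _) ∈ Ψ.target
        rw [← hΨrep x hx]
        exact Ψ.map_source hx
      map_target' := fun z hz => by
        change normalizedRep a b (inv z) ∈ Ψ.source
        rw [hrep z hz]
        exact hσs z hz
      left_inv' := fun x hx => by
        have h1 := hleft x hx
        induction x using Quotient.inductionOn with
        | h v =>
          have hcr := cross_ne_zero_of_normalizePolygon_pos (hpos _ hx).2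
          have h2 : σ (T (normalizedRep a b (PolygonSpace.mk v))) ∈ closedPolygons α := by
            rw [h1]
            exact normalizePolygon_mem v.2 hcr
          refine (dif_pos h2).trans (Eq.trans ?_ (mk_normalizePolygon v.2 hcr))
          exact congrArg _ (Subtype.ext h1)
      right_inv' := fun z hz => by
        rw [hrep z hz]
        exact (hσc z hz).2
      open_source := isOpen_preimage_normalizedRep Ψ.open_source fun v hv => (hpos v hv).2
      open_target := hR
      continuousOn_toFun := fun x hx => (T.continuous.continuousAt.comp
        (continuousAt_normalizedRep (hpos _ hx).2)).continuousWithinAt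
      continuousOn_invFun := by
        rw [continuousOn_iff_continuous_domRestrict]
        have : R.domRestrict inv = fun z : R => PolygonSpace.mk ⟨σ z.1, hσm z.1 z.2⟩ :=
          funext fun z => hinv z.1 z.2
        rw [this]
        exact PolygonSpace.isOpenQuotientMap_mk.continuous.comp
          ((continuousOn_iff_continuous_domRestrict.1 hσd.continuousOn).subtype_mk _) }
  refine ⟨φ, ⟨fun v hv => ?_, fun z hz => ?_⟩, ?_⟩
  · have hcr := cross_ne_zero_of_normalizePolygon_pos (hpos _ hv).2
    exact ⟨_, fun v => T (normalizePolygon a b v), isOpen_cross_ne_zero a b, hcr,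
      fun u hu => (T.contDiff.contDiffAt.comp u
        (contDiffAt_normalizePolygon hu)).contDiffWithinAt, fun _ _ => rfl⟩
  · exact ⟨R, σ, hz, hR, hσd, fun z hz => ⟨hσm z hz, hinv z hz⟩⟩
  · change normalizePolygon a b w ∈ Ψ.source
    rw [hn.normalizePolygon_eq]
    exact hwΨ

theorem isPolygonManifold (hα : ∀ k, 0 < α k) (hgen : IsGeneric α) : IsPolygonManifold α where
  exists_chart x := by
    induction x using Quotient.inductionOn with
    | h v =>
      obtain ⟨a, b, h⟩ := exists_cross_ne_zero hα hgen v.2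
      obtain ⟨φ, hφ, hm⟩ := exists_isPolygonChart hα (normalizePolygon_mem v.2 h)
        (isNormalized_normalizePolygon h)
      rw [mk_normalizePolygon v.2 h] at hm
      exact ⟨φ, hφ, hm⟩

end Charts

/-! ### Independence of the lift -/

section Lifts

variable {m : ℕ} {α : Fin m → ℝ} {V : Type*} [NormedAddCommGroup V] [NormedSpace ℝ V]

theorem cross_rotate_ne_zero {A : Matrix (Fin 3) (Fin 3) ℝ}
    (hA : A ∈ Matrix.specialOrthogonalGroup (Fin 3) ℝ) {a b : Fin m} {v : Fin m → E3}
    (h : cross (v a) (v b) ≠ 0) : cross (rotate A v a) (rotate A v b) ≠ 0 := by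
  change cross (act A (v a)) (act A (v b)) ≠ 0
  rw [act_cross hA, ← norm_ne_zero_iff, norm_act hA, norm_ne_zero_iff]
  exact h

theorem contDiffAt_normalizePolygon_comp {a b : Fin m} {σ : V → Fin m → E3} {z : V}
    (hσ : ContDiffAt ℝ ∞ σ z) (h : cross (σ z a) (σ z b) ≠ 0) :
    ContDiffAt ℝ ∞ (fun y => normalizePolygon a b (σ y)) z :=
  (contDiffAt_normalizePolygon h).comp z hσ

theorem eventually_cross_ne_zero {a b : Fin m} {σ : V → Fin m → E3} {z : V}
    (hσ : ContDiffAt ℝ ∞ σ z) (h : cross (σ z a) (σ z b) ≠ 0) :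
    ∀ᶠ y in nhds z, cross (σ y a) (σ y b) ≠ 0 :=
  hσ.continuousAt.preimage_mem_nhds ((isOpen_cross_ne_zero a b).mem_nhds h)

/-- Normalizing applies a rotation that varies with the parameter, which changes derivatives by this
rotation and an infinitesimal one; the product form is insensitive to both. -/
theorem familyForm_normalizePolygon (hα : ∀ k, 0 < α k) {a b : Fin m} {σ : V → Fin m → E3} {z : V}
    (hσ : ContDiffAt ℝ ∞ σ z) (hcl : ∀ᶠ y in nhds z, σ y ∈ closedPolygons α)
    (h : cross (σ z a) (σ z b) ≠ 0) (u w : V) :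
    familyForm α (fun y => normalizePolygon a b (σ y)) z ![u, w] = familyForm α σ z ![u, w] := by
  have hd := (hσ.differentiableAt (by simp)).hasFDerivAt
  have hd' := ((contDiffAt_normalizePolygon_comp hσ h).differentiableAt (by simp)).hasFDerivAt
  have key := exists_infRot_of_rotate (A := fun y => frameMatrix (σ y a) (σ y b)) hd hd'
    (fun i j => ((contDiffAt_frameMatrix h i j).comp z hσ).differentiableAt (by simp))
    ((eventually_cross_ne_zero hσ h).mono fun y hy => frameMatrix_mem hy)
    (Filter.Eventually.of_forall fun y => rfl)
  obtain ⟨κ, hκ⟩ := key u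
  obtain ⟨μ, hμ⟩ := key w
  rw [familyForm_apply, familyForm_apply, hκ, hμ]
  exact productForm_rotate_add_infRot (frameMatrix_mem h) hα hcl.self_of_nhds
    (isTangent_of_hasFDerivAt hd hcl u) (isTangent_of_hasFDerivAt hd hcl w) κ μ

/-- Two families of closed polygons represent the same classes near `z`. -/
def SameClassesAt (α : Fin m → ℝ) (σ τ : V → Fin m → E3) (z : V) : Prop :=
  ∀ᶠ y in nhds z, ∃ (hσ : σ y ∈ closedPolygons α) (hτ : τ y ∈ closedPolygons α),
    PolygonSpace.mk ⟨σ y, hσ⟩ = PolygonSpace.mk ⟨τ y, hτ⟩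

/-- Both families have the same normalization near `z`, so each is compared with that. No smooth
choice of the rotation between them is needed. -/
theorem familyForm_eq_of_sameClassesAt (hα : ∀ k, 0 < α k) (hgen : IsGeneric α)
    {σ τ : V → Fin m → E3} {z : V} (hσ : ContDiffAt ℝ ∞ σ z) (hτ : ContDiffAt ℝ ∞ τ z)
    (h : SameClassesAt α σ τ z) : familyForm α σ z = familyForm α τ z := by
  obtain ⟨hσz, hτz, hz⟩ := h.self_of_nhds
  obtain ⟨a, b, hab⟩ := exists_cross_ne_zero hα hgen hσz
  obtain ⟨A, hA, hAz⟩ := PolygonSpace.mk_eq_mk.1 hz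
  have hab' : cross (τ z a) (τ z b) ≠ 0 := by
    have := cross_rotate_ne_zero hA hab
    rwa [hAz] at this
  have hev : (fun y => normalizePolygon a b (σ y)) =ᶠ[nhds z]
      fun y => normalizePolygon a b (τ y) := by
    filter_upwards [h] with y hy
    obtain ⟨h1, h2, h3⟩ := hy
    exact congrArg (normalizedRep a b) h3
  have hz' : normalizePolygon a b (σ z) = normalizePolygon a b (τ z) := hev.self_of_nhds
  ext w
  have hw : w = ![w 0, w 1] := by
    funext i; fin_cases i <;> rfl
  rw [hw, ← familyForm_normalizePolygon hα hσ (h.mono fun y hy => hy.1) hab,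
    ← familyForm_normalizePolygon hα hτ (h.mono fun y hy => hy.2.1) hab', familyForm_apply,
    familyForm_apply, hev.fderiv_eq, hz']

end Lifts

/-! ### Nondegeneracy by Lagrange multipliers -/

section Nondegenerate

variable {m : ℕ} {α : Fin m → ℝ}

theorem inner_cross_eq (v x y : E3) : sphereForm v x y = inner ℝ (cross v x) y := by
  simp only [inner_eq_coords, sphereForm_eq, cross_zero_coord, cross_one_coord, cross_two_coord]
  ring

theorem cross_cross_self (v x : E3) :
    cross v (cross v x) = (inner ℝ v x) • v - (inner ℝ v v) • x := by
  apply E3.ext_coords <;>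
    simp only [inner_eq_coords, cross_zero_coord, cross_one_coord, cross_two_coord,
      PiLp.sub_apply, PiLp.smul_apply, smul_eq_mul] <;> ring

/-- The kernel of the product form on closed polygons consists of infinitesimal rotations. -/
theorem exists_eq_infRot (hα : ∀ k, 0 < α k) {v X : Fin m → E3} (hv : v ∈ closedPolygons α)
    (hX : IsTangent v X) (h : ∀ Y, IsTangent v Y → productForm α v X Y = 0) :
    ∃ κ, X = infRot κ v := by
  let L : (Fin m → E3) →ₗ[ℝ] (Fin m → ℝ) × E3 :=
    (LinearMap.pi fun k => (innerₛₗ ℝ (v k)).comp (LinearMap.proj k)).prod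
      (∑ k, LinearMap.proj k)
  have hL : ∀ Y, L Y = (fun k => inner ℝ (v k) (Y k), ∑ k, Y k) := fun Y => by
    refine Prod.ext (funext fun k => ?_) ?_ <;> simp [L]
  let ℓ : Module.Dual ℝ (Fin m → E3) :=
    { toFun := fun Y => productForm α v X Y
      map_add' := productForm_add_right α v X
      map_smul' := fun c Y => productForm_smul_right α c v X Y }
  have hℓ : ℓ ∈ (LinearMap.ker L).dualAnnihilator := by
    rw [Submodule.mem_dualAnnihilator]
    intro Y hY
    rw [LinearMap.mem_ker, hL] at hY
    exact h Y ⟨fun k => congrFun (congrArg Prod.fst hY) k, congrArg Prod.snd hY⟩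
  -- A functional that vanishes on `ker L` factors through `L`. The factor `g` consists of the
  -- multipliers: one scalar per length constraint and a vector `μ` for the closing constraint.
  rw [← LinearMap.range_dualMap_eq_dualAnnihilator_ker] at hℓ
  obtain ⟨g, hg⟩ := hℓ
  obtain ⟨μ, hμ⟩ : ∃ μ : E3, ∀ y : E3, g (0, y) = inner ℝ μ y := by
    refine ⟨!₂[g (0, EuclideanSpace.single 0 1), g (0, EuclideanSpace.single 1 1),
      g (0, EuclideanSpace.single 2 1)], fun y => ?_⟩
    have hy : ((0, y) : (Fin m → ℝ) × E3) = y 0 • (0, EuclideanSpace.single 0 1) +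
        y 1 • (0, EuclideanSpace.single 1 1) + y 2 • (0, EuclideanSpace.single 2 1) := by
      refine Prod.ext (by simp) ?_
      apply E3.ext_coords <;> simp
    rw [hy, map_add, map_add, map_smul, map_smul, map_smul, inner_eq_coords]
    simp
    ring
  refine ⟨μ, funext fun k => ?_⟩
  set c := α k * (α k)⁻¹ ^ 3 with hc
  set l := g (Pi.single k 1, 0) with hl
  have h1 : ∀ y : E3, c * inner ℝ (cross (v k) (X k)) y = l * inner ℝ (v k) y + inner ℝ μ y := by
    intro y
    have e1 : productForm α v X (Pi.single k y) = c * inner ℝ (cross (v k) (X k)) y := by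
      rw [productForm_eq, Finset.sum_eq_single k]
      · rw [Pi.single_eq_same, inner_cross_eq]
      · intro j _ hj
        rw [Pi.single_eq_of_ne hj, inner_cross_eq, inner_zero_right, mul_zero]
      · simp
    have e2 : L (Pi.single k y) = inner ℝ (v k) y • (Pi.single k 1, 0) + (0, y) := by
      rw [hL]
      refine Prod.ext (funext fun j => ?_) (by simp)
      by_cases hj : j = k
      · subst hj; simp
      · simp [hj]
    rw [← e1]
    change ℓ _ = _
    rw [← hg, LinearMap.dualMap_apply, e2, map_add, map_smul, hμ, smul_eq_mul, ← hl]
    ring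
  -- The multiplier equation at step `k`. Its cross product with `v k` removes `l` and, since
  -- $c|v_k|^2=1$ and `X k` is orthogonal to `v k`, leaves $X_k=\mu\times v_k$.
  have h2 : c • cross (v k) (X k) = l • v k + μ := by
    refine ext_inner_right ℝ fun y => ?_
    rw [inner_smul_left, inner_add_left, inner_smul_left]
    exact h1 y
  have h3 : cross (v k) (c • cross (v k) (X k)) = cross (v k) (l • v k + μ) := by rw [h2]
  have h4 : cross (v k) (l • v k + μ) = -cross μ (v k) := by
    apply E3.ext_coords <;> simp <;> ring
  have h5 : cross (v k) (c • cross (v k) (X k)) = c • cross (v k) (cross (v k) (X k)) := by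
    apply E3.ext_coords <;> simp <;> ring
  rw [h4, h5, cross_cross_self, hX.1 k, real_inner_self_eq_norm_sq, hv.1 k] at h3
  have h6 : c * α k ^ 2 = 1 := by
    have := (hα k).ne'
    rw [hc]; field_simp
  have h7 : c • ((0 : ℝ) • v k - α k ^ 2 • X k) = -X k := by
    rw [zero_smul, zero_sub, smul_neg, smul_smul, h6, one_smul]
  rw [h7] at h3
  exact neg_injective h3

/-- Every tangent vector is a slice vector plus an infinitesimal rotation, so a kernel vector on the
slice is a kernel vector on all tangent vectors. It is thus an infinitesimal rotation, and the only
one tangent to the slice is zero. -/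
theorem eq_zero_of_productForm_ker (hα : ∀ k, 0 < α k) {a b : Fin m} {v X : Fin m → E3}
    (hv : v ∈ closedPolygons α) (hn : IsNormalized a b v) (hX : constraintDeriv a b v X = 0)
    (h : ∀ Y, constraintDeriv a b v Y = 0 → productForm α v X Y = 0) : X = 0 := by
  have htan : ∀ Y, constraintDeriv a b v Y = 0 →
      IsTangent v Y ∧ Y a 1 = 0 ∧ Y a 2 = 0 ∧ Y b 2 = 0 := by
    intro Y hY
    rw [constraintDeriv_apply] at hY
    have h1 : ∀ i, ![Y a 1, Y a 2, Y b 2] i = 0 := congrFun (congrArg (fun x => x.2.2) hY)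
    refine ⟨⟨fun k => ?_, congrArg (fun x => x.2.1) hY⟩, h1 0, h1 1, h1 2⟩
    have h2 : 2 * inner ℝ (v k) (Y k) = 0 := congrFun (congrArg Prod.fst hY) k
    linarith
  obtain ⟨hXt, x1, x2, x3⟩ := htan X hX
  obtain ⟨κ, rfl⟩ := exists_eq_infRot hα hv hXt fun Y hY => by
    obtain ⟨μ, m1, m2, m3⟩ := hn.exists_infRot ![Y a 1, Y a 2, Y b 2]
    have hμ := isTangent_infRot hv.2 μ
    have e : Y = (Y + (-1 : ℝ) • infRot μ v) + infRot μ v := by simp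
    rw [e, productForm_add_right, productForm_swap α v X (infRot μ v),
      productForm_infRot hα hv hXt, h, neg_zero, add_zero]
    rw [constraintDeriv_apply]
    refine Prod.ext (funext fun k => ?_) (Prod.ext ?_ (funext fun i => ?_))
    · simp [inner_add_right, hY.1 k, hμ.1 k]
    · simp [Finset.sum_add_distrib, hY.2, hμ.2]
    · fin_cases i
      · simpa [add_neg_eq_zero] using m1.symm
      · simpa [add_neg_eq_zero] using m2.symm
      · simpa [add_neg_eq_zero] using m3.symm
  rw [hn.infRot_eq_zero x1 x2 x3]
  funext k
  exact E3.ext_coords (by simp [infRot]) (by simp [infRot]) (by simp [infRot])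

/-- The pullback of the product form by a normalized family of polygons that are local coordinates
of the polygon space is nondegenerate. -/
theorem familyForm_nondegenerate (hα : ∀ k, 0 < α k) {a b : Fin m}
    {ν : EuclideanSpace ℝ (Fin (2 * (m - 3))) → Fin m → E3}
    {F : (Fin m → E3) → EuclideanSpace ℝ (Fin (2 * (m - 3)))}
    {z : EuclideanSpace ℝ (Fin (2 * (m - 3)))} (hν : DifferentiableAt ℝ ν z)
    (hcl : ∀ᶠ y in nhds z, ν y ∈ closedPolygons α ∧ IsNormalized a b (ν y))
    (hF : DifferentiableAt ℝ F (ν z)) (hFν : ∀ᶠ y in nhds z, F (ν y) = y)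
    {u : EuclideanSpace ℝ (Fin (2 * (m - 3)))} (hu : ∀ w, familyForm α ν z ![u, w] = 0) :
    u = 0 := by
  obtain ⟨hv, hn⟩ := hcl.self_of_nhds
  have hker : ∀ w, constraintDeriv a b (ν z) (fderiv ℝ ν z w) = 0 := by
    intro w
    have h1 := (hasFDerivAt_constraintMap a b (ν z)).comp z hν.hasFDerivAt
    have h2 : (constraintMap a b ∘ ν) =ᶠ[nhds z] fun _ => constraintMap a b (ν z) := by
      filter_upwards [hcl] with y hy using constraintMap_eq hy.1 hv hy.2 hn
    exact DFunLike.congr_fun (h1.unique ((hasFDerivAt_const _ _).congr_of_eventuallyEq h2)) w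
  have hinv : ∀ w, fderiv ℝ F (ν z) (fderiv ℝ ν z w) = w := by
    intro w
    have h1 := hF.hasFDerivAt.comp z hν.hasFDerivAt
    have h2 : (F ∘ ν) =ᶠ[nhds z] id := hFν
    exact DFunLike.congr_fun (h1.unique ((hasFDerivAt_id _).congr_of_eventuallyEq h2)) w
  let D : EuclideanSpace ℝ (Fin (2 * (m - 3))) →ₗ[ℝ]
      LinearMap.ker (constraintDeriv a b (ν z)).toLinearMap :=
    (fderiv ℝ ν z).toLinearMap.codRestrict _ hker
  have hDi : Function.Injective D := by
    intro w w' h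
    rw [← hinv w, ← hinv w']
    exact congrArg _ (congrArg Subtype.val h)
  -- An injective map between spaces of equal dimension: the family reaches every tangent vector of
  -- the slice.
  have hDs : Function.Surjective D :=
    (LinearMap.injective_iff_surjective_of_finrank_eq_finrank
      (by rw [finrank_ker_constraintDeriv hα hv hn]; simp)).1 hDi
  have hX : fderiv ℝ ν z u = 0 := by
    refine eq_zero_of_productForm_ker hα hv hn (hker u) fun Y hY => ?_
    obtain ⟨w, hw⟩ := hDs ⟨Y, hY⟩
    have hw' : fderiv ℝ ν z w = Y := congrArg Subtype.val hw
    rw [← hw']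
    exact hu w
  rw [← hinv u, hX, map_zero]

end Nondegenerate

/-! ### Smoothness of maps with polygon lifts -/

section LiftedMaps

variable {m d : ℕ} {α : Fin m → ℝ} {V : Set (EuclideanSpace ℝ (Fin d))}
  {σ : EuclideanSpace ℝ (Fin d) → Fin m → E3} {p : EuclideanSpace ℝ (Fin d) → PolygonSpace α}
  {z : EuclideanSpace ℝ (Fin d)}

theorem IsSmoothLift.contDiffAt (h : IsSmoothLift α V σ p) (hz : z ∈ V) : ContDiffAt ℝ ∞ σ z :=
  h.2.1.contDiffAt (h.1.mem_nhds hz)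

theorem IsSmoothLift.eventually (h : IsSmoothLift α V σ p) (hz : z ∈ V) :
    ∀ᶠ y in nhds z, ∃ hy : σ y ∈ closedPolygons α, p y = PolygonSpace.mk ⟨σ y, hy⟩ :=
  Filter.mem_of_superset (h.1.mem_nhds hz) h.2.2

theorem IsSmoothLift.continuousAt (h : IsSmoothLift α V σ p) (hz : z ∈ V) : ContinuousAt p z := by
  have hc : ContinuousOn p V := by
    rw [continuousOn_iff_continuous_domRestrict]
    have : V.domRestrict p = fun y : V => PolygonSpace.mk ⟨σ y.1, (h.2.2 y.1 y.2).choose⟩ :=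
      funext fun y => (h.2.2 y.1 y.2).choose_spec
    rw [this]
    exact PolygonSpace.isOpenQuotientMap_mk.continuous.comp
      ((continuousOn_iff_continuous_domRestrict.1 h.2.1.continuousOn).subtype_mk _)
  exact hc.continuousAt (h.1.mem_nhds hz)

theorem IsPolygonChart.exists_contDiffAt
    {φ : OpenPartialHomeomorph (PolygonSpace α) (EuclideanSpace ℝ (Fin (2 * (m - 3))))}
    (hφ : IsPolygonChart α φ) (h : IsSmoothLift α V σ p) (hz : z ∈ V) (hp : p z ∈ φ.source) :
    ∃ F : (Fin m → E3) → EuclideanSpace ℝ (Fin (2 * (m - 3))),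
      ContDiffAt ℝ ∞ F (σ z) ∧ ∀ᶠ y in nhds z, φ (p y) = F (σ y) := by
  obtain ⟨hσz, hpz⟩ := h.2.2 z hz
  rw [hpz] at hp
  obtain ⟨U, F, hU, hzU, hF, hφF⟩ := hφ.smooth _ hp
  refine ⟨F, hF.contDiffAt (hU.mem_nhds hzU), ?_⟩
  filter_upwards [h.eventually hz,
    (h.contDiffAt hz).continuousAt.preimage_mem_nhds (hU.mem_nhds hzU)] with y hy hyU
  obtain ⟨hσy, hpy⟩ := hy
  rw [hpy]
  exact hφF _ hyU

theorem IsPolygonChart.contDiffAt_comp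
    {φ : OpenPartialHomeomorph (PolygonSpace α) (EuclideanSpace ℝ (Fin (2 * (m - 3))))}
    (hφ : IsPolygonChart α φ) (h : IsSmoothLift α V σ p) (hz : z ∈ V) (hp : p z ∈ φ.source) :
    ContDiffAt ℝ ∞ (φ ∘ p) z := by
  obtain ⟨F, hF, hFe⟩ := hφ.exists_contDiffAt h hz hp
  exact (hF.comp z (h.contDiffAt hz)).congr_of_eventuallyEq hFe

theorem isPolygonChart_chartAt [IsPolygonManifold α] (x : PolygonSpace α) :
    IsPolygonChart α (chartAt (EuclideanSpace ℝ (Fin (2 * (m - 3)))) x) :=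
  chart_mem_atlas (EuclideanSpace ℝ (Fin (2 * (m - 3)))) x

theorem IsSmoothLift.contMDiffAt [IsPolygonManifold α] (h : IsSmoothLift α V σ p) (hz : z ∈ V) :
    ContMDiffAt (𝓡 d) (𝓡 (2 * (m - 3))) ∞ p z := by
  rw [contMDiffAt_iff_target]
  refine ⟨h.continuousAt hz, ?_⟩
  rw [contMDiffAt_iff_contDiffAt]
  exact (isPolygonChart_chartAt (p z)).contDiffAt_comp h hz (mem_chart_source _ _)

end LiftedMaps

/-! ### Existence and symplecticity of the reduced form -/

section ReducedForm

variable {m : ℕ} (α : Fin m → ℝ) [IsPolygonManifold α]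

theorem exists_chartLift (x : PolygonSpace α) :
    ∃ (σ : EuclideanSpace ℝ (Fin (2 * (m - 3))) → Fin m → E3)
      (V : Set (EuclideanSpace ℝ (Fin (2 * (m - 3))))),
      chartAt (EuclideanSpace ℝ (Fin (2 * (m - 3)))) x x ∈ V ∧
        IsSmoothLift α V σ (chartAt (EuclideanSpace ℝ (Fin (2 * (m - 3)))) x).symm := by
  obtain ⟨V, σ, hz, hl⟩ := (isPolygonChart_chartAt x).smooth_lift _ (mem_chart_target _ x)
  exact ⟨σ, V, hz, hl⟩

/-- A lift of the inverse of the preferred chart at `x`. -/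
noncomputable def chartLift (x : PolygonSpace α) :
    EuclideanSpace ℝ (Fin (2 * (m - 3))) → Fin m → E3 := (exists_chartLift α x).choose

/-- The reduced form on `M(α)`. -/
noncomputable def reducedForm : TwoForm (2 * (m - 3)) (PolygonSpace α) := fun x =>
  (familyForm α (chartLift α x)
    (chartAt (EuclideanSpace ℝ (Fin (2 * (m - 3)))) x x)).compContinuousLinearMap
    (mfderiv (𝓡 (2 * (m - 3))) (𝓡 (2 * (m - 3)))
      (chartAt (EuclideanSpace ℝ (Fin (2 * (m - 3)))) x) x)

theorem reducedForm_apply (x : PolygonSpace α) (u w : TangentSpace (𝓡 (2 * (m - 3))) x) :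
    reducedForm α x ![u, w] = familyForm α (chartLift α x)
      (chartAt (EuclideanSpace ℝ (Fin (2 * (m - 3)))) x x)
      ![mfderiv (𝓡 (2 * (m - 3))) (𝓡 (2 * (m - 3)))
          (chartAt (EuclideanSpace ℝ (Fin (2 * (m - 3)))) x) x u,
        mfderiv (𝓡 (2 * (m - 3))) (𝓡 (2 * (m - 3)))
          (chartAt (EuclideanSpace ℝ (Fin (2 * (m - 3)))) x) x w] := rfl

variable {α}

theorem TwoForm.pullback_apply {d d' : ℕ} {M N : Type*} [TopologicalSpace M]
    [ChartedSpace (EuclideanSpace ℝ (Fin d)) M] [TopologicalSpace N]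
    [ChartedSpace (EuclideanSpace ℝ (Fin d')) N] (f : M → N) (Ω : TwoForm d' N) (x : M)
    (u w : TangentSpace (𝓡 d) x) :
    TwoForm.pullback (d := d) f Ω x ![u, w] =
      Ω (f x) ![mfderiv (𝓡 d) (𝓡 d') f x u, mfderiv (𝓡 d) (𝓡 d') f x w] := by
  refine congrArg (Ω (f x)) ?_
  funext i
  fin_cases i <;> rfl

theorem isReducedForm_reducedForm (hα : ∀ k, 0 < α k) (hgen : IsGeneric α) :
    IsReducedForm α (reducedForm α) := by
  intro d V σ p hl z hz u w
  refine (TwoForm.pullback_apply p (reducedForm α) z u w).trans ?_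
  set φ := chartAt (EuclideanSpace ℝ (Fin (2 * (m - 3)))) (p z) with hφ
  obtain ⟨W, hxW, hW⟩ := (exists_chartLift α (p z)).choose_spec
  change IsSmoothLift α W (chartLift α (p z)) φ.symm at hW
  set τ := chartLift α (p z) with hτ
  set q := φ ∘ p with hq
  have hqd : ContDiffAt ℝ ∞ q z :=
    (isPolygonChart_chartAt (p z)).contDiffAt_comp hl hz (mem_chart_source _ _)
  have hchain : ∀ u, mfderiv (𝓡 (2 * (m - 3))) (𝓡 (2 * (m - 3))) φ (p z)
      (mfderiv (𝓡 d) (𝓡 (2 * (m - 3))) p z u) = fderiv ℝ q z u := by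
    intro u
    have h1 := mfderiv_comp (I := 𝓡 d) (I' := 𝓡 (2 * (m - 3))) (I'' := 𝓡 (2 * (m - 3))) z
      ((mdifferentiable_chart (I := 𝓡 (2 * (m - 3))) (p z)).mdifferentiableAt
        (mem_chart_source _ (p z)))
      ((hl.contMDiffAt hz).mdifferentiableAt (by simp))
    rw [← mfderiv_eq_fderiv]
    exact (DFunLike.congr_fun h1 u).symm
  refine ((reducedForm_apply α (p z) _ _).trans (congrArg₂
    (fun u w => familyForm α τ (q z) ![u, w]) (hchain u) (hchain w))).trans ?_
  have hτd : ContDiffAt ℝ ∞ τ (q z) := hW.contDiffAt hxW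
  -- Composing the chart lift with the chart expression of `p` gives a second lift of `p`, so
  -- independence of the lift applies.
  have hcomp : familyForm α (τ ∘ q) z = familyForm α σ z := by
    refine familyForm_eq_of_sameClassesAt hα hgen (hτd.comp z hqd) (hl.contDiffAt hz) ?_
    filter_upwards [hl.eventually hz,
      hqd.continuousAt.preimage_mem_nhds (hW.1.mem_nhds hxW),
      (hl.continuousAt hz).preimage_mem_nhds
        (φ.open_source.mem_nhds (mem_chart_source _ (p z)))] with y hy1 hy2 hy3
    obtain ⟨h1, e1⟩ := hy1
    obtain ⟨h2, e2⟩ := hW.2.2 _ hy2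
    refine ⟨h2, h1, ?_⟩
    rw [← e1]
    refine Eq.trans ?_ (φ.left_inv hy3)
    exact e2.symm
  rw [← familyForm_apply, ← hcomp, familyForm_apply, familyForm_apply,
    fderiv_comp z (hτd.differentiableAt (by simp)) (hqd.differentiableAt (by simp))]
  rfl

theorem ContinuousAlternatingMap.ext_two {V : Type*} [NormedAddCommGroup V] [NormedSpace ℝ V]
    {f g : V [⋀^Fin 2]→L[ℝ] ℝ} (h : ∀ u w, f ![u, w] = g ![u, w]) : f = g := by
  ext x
  have hx : x = ![x 0, x 1] := by
    funext i; fin_cases i <;> rfl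
  rw [hx]
  exact h _ _

theorem IsReducedForm.pullback_eq {Ω : TwoForm (2 * (m - 3)) (PolygonSpace α)}
    (hΩ : IsReducedForm α Ω) {d : ℕ} {V : Set (EuclideanSpace ℝ (Fin d))}
    {σ : EuclideanSpace ℝ (Fin d) → Fin m → E3} {p : EuclideanSpace ℝ (Fin d) → PolygonSpace α}
    (hl : IsSmoothLift α V σ p) {z : EuclideanSpace ℝ (Fin d)} (hz : z ∈ V) :
    TwoForm.pullback (d := d) p Ω z = familyForm α σ z :=
  ContinuousAlternatingMap.ext_two fun u w => hΩ d V σ p hl z hz u w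

/-- In a chart the form is the `familyForm` of a lift of the chart inverse, which gives smoothness
and closedness. For nondegeneracy the lift is normalized, and the chart supplies the left inverse
required by `familyForm_nondegenerate`. -/
theorem isSymplecticForm_of_isReducedForm (hα : ∀ k, 0 < α k) (hgen : IsGeneric α)
    {Ω : TwoForm (2 * (m - 3)) (PolygonSpace α)} (hΩ : IsReducedForm α Ω) :
    IsSymplecticForm Ω := by
  have hloc : ∀ φ ∈ atlas (EuclideanSpace ℝ (Fin (2 * (m - 3)))) (PolygonSpace α),
      ∀ z ∈ φ.target, ∃ σ : EuclideanSpace ℝ (Fin (2 * (m - 3))) → Fin m → E3,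
        ContDiffAt ℝ ∞ σ z ∧ (∀ᶠ y in nhds z, σ y ∈ closedPolygons α) ∧
          Ω.inChart φ =ᶠ[nhds z] familyForm α σ := by
    intro φ hφ z hz
    obtain ⟨V, σ, hzV, hl⟩ := IsPolygonChart.smooth_lift (α := α) hφ z hz
    refine ⟨σ, hl.contDiffAt hzV, (hl.eventually hzV).mono fun y hy => hy.1, ?_⟩
    filter_upwards [hl.1.mem_nhds hzV] with y hy
    exact hΩ.pullback_eq hl hy
  refine ⟨fun φ hφ z hz => ?_, fun φ hφ z hz => ?_, fun x u hu => ?_⟩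
  · obtain ⟨σ, hσ, -, he⟩ := hloc φ hφ z hz
    exact (hσ.familyForm.congr_of_eventuallyEq he).contDiffWithinAt
  · obtain ⟨σ, hσ, hcl, he⟩ := hloc φ hφ z hz
    rw [he.extDeriv_eq, extDeriv_familyForm hα hσ hcl]
  · set φ := chartAt (EuclideanSpace ℝ (Fin (2 * (m - 3)))) x with hφ
    have hφa : IsPolygonChart α φ := isPolygonChart_chartAt x
    have hmd := mdifferentiable_chart (I := 𝓡 (2 * (m - 3))) x
    have hxs := mem_chart_source (EuclideanSpace ℝ (Fin (2 * (m - 3)))) x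
    have hxt := mem_chart_target (EuclideanSpace ℝ (Fin (2 * (m - 3)))) x
    obtain ⟨V, σ, hzV, hl⟩ := hφa.smooth_lift _ hxt
    set z := φ x with hz
    have hcl := hl.eventually hzV
    obtain ⟨hσz, hpz⟩ := hcl.self_of_nhds
    obtain ⟨a, b, hab⟩ := exists_cross_ne_zero hα hgen hσz
    obtain ⟨W, hzW, hWV, hWo⟩ : ∃ W, z ∈ W ∧ W ⊆ V ∩ {y | cross (σ y a) (σ y b) ≠ 0} ∧
        IsOpen W := by
      obtain ⟨W, h1, h2, h3⟩ := mem_nhds_iff.1 (Filter.inter_mem (hl.1.mem_nhds hzV)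
        (eventually_cross_ne_zero (hl.contDiffAt hzV) hab))
      exact ⟨W, h3, h1, h2⟩
    have hlν : IsSmoothLift α W (fun y => normalizePolygon a b (σ y)) φ.symm := by
      refine ⟨hWo, fun y hy => ?_, fun y hy => ?_⟩
      · exact (contDiffAt_normalizePolygon_comp (hl.contDiffAt (hWV hy).1)
          (hWV hy).2).contDiffWithinAt
      · obtain ⟨h1, h2⟩ := hl.2.2 y (hWV hy).1
        exact ⟨normalizePolygon_mem h1 (hWV hy).2,
          h2.trans (mk_normalizePolygon h1 (hWV hy).2).symm⟩
    obtain ⟨F, hF, hFe⟩ := hφa.exists_contDiffAt hlν hzW (φ.map_target hxt)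
    have hnd := familyForm_nondegenerate hα (a := a) (b := b)
      ((hlν.contDiffAt hzW).differentiableAt (by simp))
      (F := F) (u := mfderiv (𝓡 (2 * (m - 3))) (𝓡 (2 * (m - 3))) φ x u)
      (by
        filter_upwards [hWo.mem_nhds hzW] with y hy
        exact ⟨(hlν.2.2 y hy).1, isNormalized_normalizePolygon (hWV hy).2⟩)
      (hF.differentiableAt (by simp))
      (by
        filter_upwards [hFe, φ.open_target.mem_nhds hxt] with y hy hyt
        rw [← hy]
        exact φ.right_inv hyt)
      (by
        intro w
        have hid : ∀ u : TangentSpace (𝓡 (2 * (m - 3))) x,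
            mfderiv (𝓡 (2 * (m - 3))) (𝓡 (2 * (m - 3))) φ.symm z
              (mfderiv (𝓡 (2 * (m - 3))) (𝓡 (2 * (m - 3))) φ x u) = u := fun u =>
          DFunLike.congr_fun (hmd.symm_comp_deriv hxs) u
        have hx : φ.symm z = x := φ.left_inv hxs
        -- The form depends on the base point, and `φ.symm z` is `x` only propositionally; hence a
        -- variable point.
        have hzero : ∀ y, y = x → ∀ u' w : EuclideanSpace ℝ (Fin (2 * (m - 3))), u' = u →
            Ω y ![u', w] = 0 := by
          rintro y rfl u' w rfl
          exact hu w
        exact (congrArg (fun f : EuclideanSpace ℝ (Fin (2 * (m - 3))) [⋀^Fin 2]→L[ℝ] ℝ =>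
          f ![_, w]) (hΩ.pullback_eq hlν hzW).symm).trans
          ((TwoForm.pullback_apply φ.symm Ω z _ w).trans (hzero _ hx _ _ (hid u))))
    have hinj := hmd.mfderiv_injective hxs
    exact hinj (hnd.trans (map_zero _).symm)

end ReducedForm

/-! ### Transport of a smooth structure along a homeomorphism -/

section Transport

variable {d d' : ℕ} {X M N : Type*} [TopologicalSpace X] [TopologicalSpace M] [TopologicalSpace N]
  [ChartedSpace (EuclideanSpace ℝ (Fin d)) M] [ChartedSpace (EuclideanSpace ℝ (Fin d')) N]

/-- The charted space structure on `X` pulled back along a homeomorphism `X ≃ₜ N`. -/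
@[reducible]
def Homeomorph.pullbackChartedSpace (e : X ≃ₜ N) :
    ChartedSpace (EuclideanSpace ℝ (Fin d')) X where
  atlas := e.transOpenPartialHomeomorph '' atlas (EuclideanSpace ℝ (Fin d')) N
  chartAt x := e.transOpenPartialHomeomorph (chartAt _ (e x))
  mem_chart_source x := mem_chart_source (EuclideanSpace ℝ (Fin d')) (e x)
  chart_mem_atlas x := ⟨_, chart_mem_atlas _ (e x), rfl⟩

theorem Homeomorph.isManifold_pullbackChartedSpace [IsManifold (𝓡 d') ∞ N] (e : X ≃ₜ N) :
    letI := e.pullbackChartedSpace (d' := d')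
    IsManifold (𝓡 d') ∞ X := by
  let _ := e.pullbackChartedSpace (d' := d')
  have : HasGroupoid X (contDiffGroupoid ∞ (𝓡 d')) := by
    refine ⟨?_⟩
    rintro _ _ ⟨φ, hφ, rfl⟩ ⟨ψ, hψ, rfl⟩
    -- The homeomorphism cancels, so the transition maps are those of `N`.
    have h : (e.transOpenPartialHomeomorph φ).symm ≫ₕ e.transOpenPartialHomeomorph ψ =
        φ.symm ≫ₕ ψ := by
      refine OpenPartialHomeomorph.ext _ _ (fun z => ?_) (fun z => ?_) ?_
      · simp
      · simp
      · ext z; simp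
    rw [h]
    exact (contDiffGroupoid ∞ (𝓡 d')).compatible hφ hψ
  exact IsManifold.mk' _ _ _

/-- In the transported charts `e` is the identity. -/
theorem Homeomorph.contMDiff_pullbackChartedSpace [IsManifold (𝓡 d') ∞ N] (e : X ≃ₜ N) :
    letI := e.pullbackChartedSpace (d' := d')
    ContMDiff (𝓡 d') (𝓡 d') ∞ e := by
  let _ := e.pullbackChartedSpace (d' := d')
  intro x
  rw [contMDiffAt_iff]
  refine ⟨e.continuous.continuousAt, ?_⟩
  refine contDiffWithinAt_id.congr_of_eventuallyEq (Filter.Eventually.filter_mono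
    nhdsWithin_le_nhds ?_) ?_
  · filter_upwards [(chartAt (EuclideanSpace ℝ (Fin d')) (e x)).open_target.mem_nhds
      (mem_chart_target _ (e x))] with z hz
    change chartAt (EuclideanSpace ℝ (Fin d')) (e x) (e (e.symm
      ((chartAt (EuclideanSpace ℝ (Fin d')) (e x)).symm z))) = z
    rw [e.apply_symm_apply]
    exact OpenPartialHomeomorph.right_inv _ hz
  · change chartAt (EuclideanSpace ℝ (Fin d')) (e x) (e (e.symm
      ((chartAt (EuclideanSpace ℝ (Fin d')) (e x)).symm
        (chartAt (EuclideanSpace ℝ (Fin d')) (e x) (e x))))) = _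
    rw [e.apply_symm_apply]
    exact OpenPartialHomeomorph.right_inv _ (mem_chart_target _ (e x))

theorem Homeomorph.contMDiff_symm_pullbackChartedSpace [IsManifold (𝓡 d') ∞ N] (e : X ≃ₜ N) :
    letI := e.pullbackChartedSpace (d' := d')
    ContMDiff (𝓡 d') (𝓡 d') ∞ e.symm := by
  let _ := e.pullbackChartedSpace (d' := d')
  intro y
  obtain ⟨x, rfl⟩ := e.surjective y
  rw [contMDiffAt_iff]
  refine ⟨e.symm.continuous.continuousAt, ?_⟩
  have hc : (chartAt (EuclideanSpace ℝ (Fin d')) (e.symm (e x))) =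
      e.transOpenPartialHomeomorph (chartAt (EuclideanSpace ℝ (Fin d')) (e x)) := by
    rw [e.symm_apply_apply]; rfl
  have hf : ∀ z ∈ (chartAt (EuclideanSpace ℝ (Fin d')) (e x)).target,
      (extChartAt (𝓡 d') (e.symm (e x)) ∘ e.symm ∘ (extChartAt (𝓡 d') (e x)).symm) z = z := by
    intro z hz
    change (chartAt (EuclideanSpace ℝ (Fin d')) (e.symm (e x))) (e.symm
      ((chartAt (EuclideanSpace ℝ (Fin d')) (e x)).symm z)) = z
    rw [hc]
    change chartAt (EuclideanSpace ℝ (Fin d')) (e x) (e (e.symm _)) = z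
    rw [e.apply_symm_apply]
    exact OpenPartialHomeomorph.right_inv _ hz
  refine contDiffWithinAt_id.congr_of_eventuallyEq (Filter.Eventually.filter_mono
    nhdsWithin_le_nhds ?_) ?_
  · filter_upwards [(chartAt (EuclideanSpace ℝ (Fin d')) (e x)).open_target.mem_nhds
      (mem_chart_target _ (e x))] with z hz using hf z hz
  · exact hf _ (mem_chart_target _ (e x))

/-- A homeomorphism `D ≃ₜ N` whose inverse is a smooth map to `M` that pulls `ΩM` back to the
nondegenerate form `ΩN` is a symplectomorphism from the submanifold `D`. -/
theorem isSubmanifoldSymplectomorphism_of_homeomorph [IsManifold (𝓡 d') ∞ N] {ΩM : TwoForm d M}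
    {D : Set M} {ΩN : TwoForm d' N} (hN : IsSymplecticForm ΩN) (e : D ≃ₜ N) {j : N → M}
    (hj : ContMDiff (𝓡 d') (𝓡 d) ∞ j) (hje : ∀ x, j (e x) = x.1)
    (hpull : TwoForm.pullback (d := d') j ΩM = ΩN) :
    IsSubmanifoldSymplectomorphism ΩM D ΩN e := by
  let _ := e.pullbackChartedSpace (d' := d')
  have hm := e.isManifold_pullbackChartedSpace (d' := d')
  have he := e.contMDiff_pullbackChartedSpace (d' := d')
  have he' := e.contMDiff_symm_pullbackChartedSpace (d' := d')
  have hval : (Subtype.val : D → M) = j ∘ e := funext fun x => (hje x).symm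
  have hvs : ContMDiff (𝓡 d') (𝓡 d) ∞ (Subtype.val : D → M) := by
    rw [hval]
    exact hj.comp he
  let Φ : D ≃ₘ^∞⟮𝓡 d', 𝓡 d'⟯ N := ⟨e.toEquiv, he, he'⟩
  have hchain : ∀ x : D, mfderiv (𝓡 d') (𝓡 d) (j ∘ e) x =
      (mfderiv (𝓡 d') (𝓡 d) j (e x)).comp (mfderiv (𝓡 d') (𝓡 d') e x) := fun x =>
    mfderiv_comp x (hj.mdifferentiable (by simp) (e x)) (he.mdifferentiable (by simp) x)
  have hform : TwoForm.pullback (d := d') (M := D) Φ ΩN =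
      TwoForm.pullback (d := d') (Subtype.val : D → M) ΩM := by
    rw [hval]
    funext x
    change _ = (ΩM (j (e x))).compContinuousLinearMap (mfderiv (𝓡 d') (𝓡 d) (j ∘ e) x)
    rw [hchain x, ← hpull]
    rfl
  refine ⟨inferInstance, hm, hvs, fun x => ?_, Φ, fun x => rfl, hform⟩
  have hΦ : Function.Bijective (mfderiv (𝓡 d') (𝓡 d') Φ x) := by
    rw [← Φ.mfderivToContinuousLinearEquiv_coe (by simp)]
    exact (Φ.mfderivToContinuousLinearEquiv (by simp) x).bijective
  rw [injective_iff_map_eq_zero]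
  intro u hu
  -- If the inclusion kills `u`, then the equality of pullbacks puts the image of `u` under the
  -- derivative of `Φ` in the kernel of `ΩN`.
  refine hΦ.1 (Eq.trans (hN.nondegenerate _ _ fun w => ?_) (map_zero _).symm)
  obtain ⟨w, rfl⟩ := hΦ.2 w
  have h1 := TwoForm.pullback_apply (d := d') (Subtype.val : D → M) ΩM x u w
  rw [← hform, hu] at h1
  refine ((TwoForm.pullback_apply (d := d') (M := D) Φ ΩN x u w).symm.trans h1).trans ?_
  exact (ΩM x.1).map_coord_zero 0 rfl

end Transport

/-! ### Splitting the last step into two parallel steps -/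

section Splitting

variable {n : ℕ} {i j : Fin (n + 2)} (hij : i ≠ j)

theorem otherIndices_mem_compl (k : Fin n) :
    otherIndices i j hij k ∈ ({i, j} : Finset (Fin (n + 2)))ᶜ :=
  Finset.orderEmbOfFin_mem _ _ k

theorem otherIndices_ne_left (k : Fin n) : otherIndices i j hij k ≠ i := fun h => by
  have := otherIndices_mem_compl hij k
  simp [h] at this

theorem otherIndices_ne_right (k : Fin n) : otherIndices i j hij k ≠ j := fun h => by
  have := otherIndices_mem_compl hij k
  simp [h] at this

theorem forall_index_iff {P : Fin (n + 2) → Prop} :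
    (∀ k, P k) ↔ P i ∧ P j ∧ ∀ k, P (otherIndices i j hij k) := by
  refine ⟨fun h => ⟨h _, h _, fun k => h _⟩, fun ⟨hi, hj, ho⟩ k => ?_⟩
  by_cases hki : k = i
  · rwa [hki]
  by_cases hkj : k = j
  · rwa [hkj]
  have hk : k ∈ Set.range (otherIndices i j hij) := by
    rw [otherIndices, Finset.range_orderEmbOfFin]
    simp [hki, hkj]
  obtain ⟨l, rfl⟩ := hk
  exact ho l

theorem sum_index {G : Type*} [AddCommMonoid G] (f : Fin (n + 2) → G) :
    ∑ k, f k = ∑ k, f (otherIndices i j hij k) + (f i + f j) := by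
  rw [← Finset.sum_compl_add_sum {i, j}, Finset.sum_pair hij]
  congr 1
  conv_lhs => rw [← Finset.map_orderEmbOfFin_univ (({i, j} : Finset (Fin (n + 2)))ᶜ)
    (by rw [Finset.card_compl, Finset.card_pair hij, Fintype.card_fin])]
  rw [Finset.sum_map]
  rfl

theorem dropTwoAppend_castSucc {X : Type*} (f : Fin (n + 2) → X) (x : X) (k : Fin n) :
    dropTwoAppend i j hij f x k.castSucc = f (otherIndices i j hij k) :=
  Fin.snoc_castSucc (α := fun _ => X) _ _ _

theorem dropTwoAppend_last {X : Type*} (f : Fin (n + 2) → X) (x : X) :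
    dropTwoAppend i j hij f x (Fin.last n) = x :=
  Fin.snoc_last (α := fun _ => X) _ _

/-- The function on all indices with the given values away from `i` and `j`, at `i` and at `j`. -/
noncomputable def assemble {X : Type*} (f : Fin n → X) (x y : X) : Fin (n + 2) → X :=
  Function.extend (otherIndices i j hij) f fun k => if k = i then x else y

theorem assemble_other {X : Type*} (f : Fin n → X) (x y : X) (k : Fin n) :
    assemble hij f x y (otherIndices i j hij k) = f k :=
  (otherIndices i j hij).injective.extend_apply _ _ _

theorem assemble_left {X : Type*} (f : Fin n → X) (x y : X) : assemble hij f x y i = x := by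
  rw [assemble, Function.extend_apply' _ _ _ (fun ⟨k, hk⟩ => otherIndices_ne_left hij k hk),
    if_pos rfl]

theorem assemble_right {X : Type*} (f : Fin n → X) (x y : X) : assemble hij f x y j = y := by
  rw [assemble, Function.extend_apply' _ _ _ (fun ⟨k, hk⟩ => otherIndices_ne_right hij k hk),
    if_neg hij.symm]

/-- The linear map that replaces the last step `x` by the steps `c • x` and `c' • x`. -/
noncomputable def splitSteps (c c' : ℝ) : (Fin (n + 1) → E3) →L[ℝ] (Fin (n + 2) → E3) :=
  ContinuousLinearMap.pi (assemble hij (fun k => ContinuousLinearMap.proj k.castSucc)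
    (c • ContinuousLinearMap.proj (Fin.last n)) (c' • ContinuousLinearMap.proj (Fin.last n)))

variable (c c' : ℝ)

theorem splitSteps_other (w : Fin (n + 1) → E3) (k : Fin n) :
    splitSteps hij c c' w (otherIndices i j hij k) = w k.castSucc := by
  rw [splitSteps, ContinuousLinearMap.pi_apply, assemble_other]; rfl

theorem splitSteps_left (w : Fin (n + 1) → E3) :
    splitSteps hij c c' w i = c • w (Fin.last n) := by
  rw [splitSteps, ContinuousLinearMap.pi_apply, assemble_left]; rfl

theorem splitSteps_right (w : Fin (n + 1) → E3) :
    splitSteps hij c c' w j = c' • w (Fin.last n) := by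
  rw [splitSteps, ContinuousLinearMap.pi_apply, assemble_right]; rfl

theorem rotate_splitSteps (A : Matrix (Fin 3) (Fin 3) ℝ) (w : Fin (n + 1) → E3) :
    rotate A (splitSteps hij c c' w) = splitSteps hij c c' (rotate A w) := by
  refine funext ((forall_index_iff hij).2 ⟨?_, ?_, fun k => ?_⟩)
  · rw [splitSteps_left, rotate, splitSteps_left, map_smul]; rfl
  · rw [splitSteps_right, rotate, splitSteps_right, map_smul]; rfl
  · rw [splitSteps_other, rotate, splitSteps_other]; rfl

theorem mergeSteps_castSucc (v : Fin (n + 2) → E3) (k : Fin n) :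
    mergeSteps i j hij v k.castSucc = v (otherIndices i j hij k) :=
  dropTwoAppend_castSucc hij _ _ _

theorem mergeSteps_last (v : Fin (n + 2) → E3) :
    mergeSteps i j hij v (Fin.last n) = v i + v j :=
  dropTwoAppend_last hij _ _

theorem rotate_mergeSteps (A : Matrix (Fin 3) (Fin 3) ℝ) (v : Fin (n + 2) → E3) :
    rotate A (mergeSteps i j hij v) = mergeSteps i j hij (rotate A v) := by
  refine funext (Fin.lastCases ?_ fun k => ?_)
  · rw [mergeSteps_last, rotate, mergeSteps_last, map_add]; rfl
  · rw [mergeSteps_castSucc, rotate, mergeSteps_castSucc]; rfl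

theorem continuous_mergeSteps : Continuous (mergeSteps i j hij) := by
  refine continuous_pi (Fin.lastCases ?_ fun k => ?_)
  · simp only [mergeSteps_last]; fun_prop
  · simp only [mergeSteps_castSucc]; fun_prop

variable {c c'}

theorem mergeSteps_splitSteps (hc : c + c' = 1) (w : Fin (n + 1) → E3) :
    mergeSteps i j hij (splitSteps hij c c' w) = w := by
  refine funext (Fin.lastCases ?_ fun k => ?_)
  · rw [mergeSteps_last, splitSteps_left, splitSteps_right, ← add_smul, hc, one_smul]
  · rw [mergeSteps_castSucc, splitSteps_other]

/-- The hypothesis puts the two steps in the ratio $c:c'$; together with $c+c'=1$ it gives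
$v_i=c(v_i+v_j)$ and $v_j=c'(v_i+v_j)$. -/
theorem splitSteps_mergeSteps (hc : c + c' = 1) {v : Fin (n + 2) → E3}
    (hv : c' • v i = c • v j) : splitSteps hij c c' (mergeSteps i j hij v) = v := by
  refine funext ((forall_index_iff hij).2 ⟨?_, ?_, fun k => ?_⟩)
  · rw [splitSteps_left, mergeSteps_last, smul_add, ← hv, ← add_smul, hc, one_smul]
  · rw [splitSteps_right, mergeSteps_last, smul_add, hv, ← add_smul, hc, one_smul]
  · rw [splitSteps_other, mergeSteps_castSucc]

variable {α : Fin (n + 2) → ℝ} {γ : ℝ}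

theorem splitSteps_mem (hc : c + c' = 1) (hi : |c| * γ = α i) (hj : |c'| * γ = α j)
    {w : Fin (n + 1) → E3} (hw : w ∈ closedPolygons (dropTwoAppend i j hij α γ)) :
    splitSteps hij c c' w ∈ closedPolygons α := by
  have hl : ‖w (Fin.last n)‖ = γ := by rw [hw.1, dropTwoAppend_last]
  refine ⟨(forall_index_iff hij).2 ⟨?_, ?_, fun k => ?_⟩, ?_⟩
  · rw [splitSteps_left, norm_smul, hl, Real.norm_eq_abs, hi]
  · rw [splitSteps_right, norm_smul, hl, Real.norm_eq_abs, hj]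
  · rw [splitSteps_other, hw.1, dropTwoAppend_castSucc]
  · rw [sum_index hij, splitSteps_left, splitSteps_right, ← add_smul, hc, one_smul]
    simp only [splitSteps_other]
    rw [← Fin.sum_univ_castSucc, hw.2]

theorem mergeSteps_mem (hα : ∀ k, 0 < α k) (hc : c + c' = 1) (hi : |c| * γ = α i)
    {v : Fin (n + 2) → E3} (hv : v ∈ closedPolygons α) (hp : c' • v i = c • v j) :
    mergeSteps i j hij v ∈ closedPolygons (dropTwoAppend i j hij α γ) := by
  have hci : v i = c • (v i + v j) := by rw [smul_add, ← hp, ← add_smul, hc, one_smul]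
  have hc0 : |c| ≠ 0 := fun h => (hα i).ne (by rw [← hi, h, zero_mul])
  refine ⟨fun k => ?_, ?_⟩
  · revert k
    refine Fin.lastCases ?_ fun k => ?_
    swap
    · rw [mergeSteps_castSucc, dropTwoAppend_castSucc, hv.1]
    rw [mergeSteps_last, dropTwoAppend_last]
    have h1 := hv.1 i
    rw [hci, norm_smul, Real.norm_eq_abs, ← hi] at h1
    exact mul_left_cancel₀ hc0 h1
  · rw [Fin.sum_univ_castSucc, mergeSteps_last]
    simp only [mergeSteps_castSucc]
    rw [← sum_index hij, hv.2]

/-- The weight $\alpha_i^{-2}=(|c|\gamma)^{-2}$ times the cubic factor $c^3$ is $c\gamma^{-2}$, with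
the sign of `c` retained, and likewise for `c'`. The two contributions add up because $c+c'=1$, even
when one coefficient is negative. -/
theorem productForm_splitSteps (hα : ∀ k, 0 < α k) (hc : c + c' = 1) (hi : |c| * γ = α i)
    (hj : |c'| * γ = α j) (w x y : Fin (n + 1) → E3) :
    productForm α (splitSteps hij c c' w) (splitSteps hij c c' x) (splitSteps hij c c' y) =
      productForm (dropTwoAppend i j hij α γ) w x y := by
  have hγ : γ ≠ 0 := fun h => (hα i).ne (by rw [← hi, h, mul_zero])
  have hc0 : c ≠ 0 := fun h => (hα i).ne (by rw [← hi, h, abs_zero, zero_mul])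
  have hc0' : c' ≠ 0 := fun h => (hα j).ne (by rw [← hj, h, abs_zero, zero_mul])
  rw [productForm_eq, productForm_eq, sum_index hij, Fin.sum_univ_castSucc]
  simp only [splitSteps_other, splitSteps_left, splitSteps_right, dropTwoAppend_last,
    dropTwoAppend_castSucc]
  congr 1
  have hs : ∀ c : ℝ, sphereForm (c • w (Fin.last n)) (c • x (Fin.last n)) (c • y (Fin.last n)) =
      c ^ 3 * sphereForm (w (Fin.last n)) (x (Fin.last n)) (y (Fin.last n)) := fun c => by
    simp only [sphereForm_eq, PiLp.smul_apply, smul_eq_mul]; ring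
  have hk : ∀ (c a : ℝ), c ≠ 0 → |c| * γ = a → a * a⁻¹ ^ 3 * c ^ 3 = c * γ⁻¹ ^ 2 := by
    rintro c a h0 rfl
    have h1 : (|c|) ^ 2 = c ^ 2 := sq_abs c
    have h2 : |c| ≠ 0 := abs_ne_zero.2 h0
    field_simp
    rw [h1]
  rw [hs, hs, ← mul_assoc, ← mul_assoc, hk c _ hc0 hi, hk c' _ hc0' hj, ← add_mul, ← add_mul, hc]
  field_simp

theorem dropTwoAppend_pos (hα : ∀ k, 0 < α k) (hγ : 0 < γ) (k : Fin (n + 1)) :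
    0 < dropTwoAppend i j hij α γ k := by
  induction k using Fin.lastCases with
  | last => rwa [dropTwoAppend_last]
  | cast k => rw [dropTwoAppend_castSucc]; exact hα _

/-- Since $\gamma=(c+c')\gamma=\operatorname{sgn}(c)\,\alpha_i+\operatorname{sgn}(c')\,\alpha_j$, a
signed sum of the merged lengths is a signed sum of the original ones. -/
theorem isGeneric_dropTwoAppend (hα : ∀ k, 0 < α k) (hgen : IsGeneric α) (hc : c + c' = 1)
    (hi : |c| * γ = α i) (hj : |c'| * γ = α j) : IsGeneric (dropTwoAppend i j hij α γ) := by
  intro e he h0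
  have hc0 : c ≠ 0 := fun h => (hα i).ne (by rw [← hi, h, abs_zero, zero_mul])
  have hc0' : c' ≠ 0 := fun h => (hα j).ne (by rw [← hj, h, abs_zero, zero_mul])
  have hsgn : ∀ c : ℝ, c ≠ 0 → ∃ s : ℝ, (s = 1 ∨ s = -1) ∧ s * |c| = c := by
    intro c h
    rcases lt_or_gt_of_ne h with h | h
    · exact ⟨-1, Or.inr rfl, by rw [abs_of_neg h]; ring⟩
    · exact ⟨1, Or.inl rfl, by rw [abs_of_pos h]; ring⟩
  obtain ⟨s, hs, hsc⟩ := hsgn c hc0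
  obtain ⟨s', hs', hsc'⟩ := hsgn c' hc0'
  have hmul : ∀ x y : ℝ, (x = 1 ∨ x = -1) → (y = 1 ∨ y = -1) → x * y = 1 ∨ x * y = -1 := by
    rintro x y (rfl | rfl) (rfl | rfl) <;> simp
  refine hgen (assemble hij (fun k => e k.castSucc) (e (Fin.last n) * s) (e (Fin.last n) * s'))
    ((forall_index_iff hij).2 ⟨?_, ?_, fun k => ?_⟩) ?_
  · rw [assemble_left]; exact hmul _ _ (he _) hs
  · rw [assemble_right]; exact hmul _ _ (he _) hs'
  · rw [assemble_other]; exact he _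
  · rw [Fin.sum_univ_castSucc] at h0
    simp only [dropTwoAppend_last, dropTwoAppend_castSucc] at h0
    rw [sum_index hij]
    simp only [assemble_other, assemble_left, assemble_right]
    rw [← h0, ← hi, ← hj]
    congr 1
    linear_combination e (Fin.last n) * γ * hsc + e (Fin.last n) * γ * hsc' +
      e (Fin.last n) * γ * hc

/-- The map `M(α') → M(α)` induced by splitting the last step into parallel steps. -/
noncomputable def splitMap (hc : c + c' = 1) (hi : |c| * γ = α i) (hj : |c'| * γ = α j) :
    PolygonSpace (dropTwoAppend i j hij α γ) → PolygonSpace α :=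
  Quotient.map (fun w => ⟨splitSteps hij c c' w.1, splitSteps_mem hij hc hi hj w.2⟩) (by
    rintro v w ⟨A, hA, h⟩
    exact ⟨A, hA, by rw [rotate_splitSteps, h]⟩)

theorem continuous_splitMap (hc : c + c' = 1) (hi : |c| * γ = α i) (hj : |c'| * γ = α j) :
    Continuous (splitMap hij hc hi hj) := by
  refine PolygonSpace.isOpenQuotientMap_mk.continuous_comp_iff.1 ?_
  exact PolygonSpace.isOpenQuotientMap_mk.continuous.comp
    (((splitSteps hij c c').continuous.comp continuous_subtype_val).subtype_mk _)

theorem IsSmoothLift.splitMap_comp (hc : c + c' = 1) (hi : |c| * γ = α i) (hj : |c'| * γ = α j)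
    {d : ℕ} {V : Set (EuclideanSpace ℝ (Fin d))} {σ : EuclideanSpace ℝ (Fin d) → Fin (n + 1) → E3}
    {p : EuclideanSpace ℝ (Fin d) → PolygonSpace (dropTwoAppend i j hij α γ)}
    (h : IsSmoothLift (dropTwoAppend i j hij α γ) V σ p) :
    IsSmoothLift α V (fun z => splitSteps hij c c' (σ z)) (splitMap hij hc hi hj ∘ p) := by
  refine ⟨h.1, (splitSteps hij c c').contDiff.comp_contDiffOn h.2.1, fun z hz => ?_⟩
  obtain ⟨h1, h2⟩ := h.2.2 z hz
  refine ⟨splitSteps_mem hij hc hi hj h1, ?_⟩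
  rw [Function.comp_apply, h2]
  rfl

/-- Splitting is linear on polygons, so it carries a lift of a chart inverse to a smooth lift. -/
theorem contMDiff_splitMap [IsPolygonManifold α] [IsPolygonManifold (dropTwoAppend i j hij α γ)]
    (hc : c + c' = 1) (hi : |c| * γ = α i) (hj : |c'| * γ = α j) :
    ContMDiff (𝓡 (2 * (n + 1 - 3))) (𝓡 (2 * (n + 2 - 3))) ∞ (splitMap hij hc hi hj) := by
  intro y
  set φ := chartAt (EuclideanSpace ℝ (Fin (2 * (n + 1 - 3)))) y with hφ
  obtain ⟨V, σ, hz, hl⟩ := (isPolygonChart_chartAt y).smooth_lift _ (mem_chart_target _ y)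
  have h1 := (hl.splitMap_comp hij hc hi hj).contMDiffAt hz
  have h2 : ContMDiffAt (𝓡 (2 * (n + 1 - 3))) (𝓡 (2 * (n + 1 - 3))) ∞ φ y :=
    contMDiffAt_of_mem_maximalAtlas (IsManifold.chart_mem_maximalAtlas y) (mem_chart_source _ y)
  refine (h1.comp y h2).congr_of_eventuallyEq ?_
  filter_upwards [φ.open_source.mem_nhds (mem_chart_source _ y)] with x hx
  change _ = splitMap hij hc hi hj (φ.symm (φ x))
  rw [φ.left_inv hx]

theorem familyForm_splitSteps (hα : ∀ k, 0 < α k) (hc : c + c' = 1) (hi : |c| * γ = α i)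
    (hj : |c'| * γ = α j) {V : Type*} [NormedAddCommGroup V] [NormedSpace ℝ V]
    {σ : V → Fin (n + 1) → E3} {z : V} (hσ : DifferentiableAt ℝ σ z) :
    familyForm α (fun y => splitSteps hij c c' (σ y)) z =
      familyForm (dropTwoAppend i j hij α γ) σ z := by
  refine ContinuousAlternatingMap.ext_two fun u w => ?_
  have hd : HasFDerivAt (fun y => splitSteps hij c c' (σ y))
      ((splitSteps hij c c').comp (fderiv ℝ σ z)) z :=
    (splitSteps hij c c').hasFDerivAt.comp z hσ.hasFDerivAt
  rw [familyForm_apply, familyForm_apply, hd.fderiv]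
  exact productForm_splitSteps hij hα hc hi hj _ _ _

/-- After pullback along the inverse of a chart, both sides are forms of lifts, where
`familyForm_splitSteps` compares them. The derivative of that inverse is surjective, so the equality
descends. -/
theorem pullback_splitMap [IsPolygonManifold α] [IsPolygonManifold (dropTwoAppend i j hij α γ)]
    (hα : ∀ k, 0 < α k) (hc : c + c' = 1) (hi : |c| * γ = α i) (hj : |c'| * γ = α j)
    {Ω : TwoForm (2 * (n + 2 - 3)) (PolygonSpace α)} (hΩ : IsReducedForm α Ω)
    {Ω' : TwoForm (2 * (n + 1 - 3)) (PolygonSpace (dropTwoAppend i j hij α γ))}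
    (hΩ' : IsReducedForm (dropTwoAppend i j hij α γ) Ω') :
    TwoForm.pullback (d := 2 * (n + 1 - 3)) (splitMap hij hc hi hj) Ω = Ω' := by
  funext y
  set φ := chartAt (EuclideanSpace ℝ (Fin (2 * (n + 1 - 3)))) y with hφ
  obtain ⟨V, σ, hz, hl⟩ := (isPolygonChart_chartAt y).smooth_lift _ (mem_chart_target _ y)
  have hmd := mdifferentiable_chart (I := 𝓡 (2 * (n + 1 - 3))) y
  have hyt := mem_chart_target (EuclideanSpace ℝ (Fin (2 * (n + 1 - 3)))) y
  set z := φ y with hzdef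
  have h1 := hΩ.pullback_eq (hl.splitMap_comp hij hc hi hj) hz
  have h2 := hΩ'.pullback_eq hl hz
  rw [familyForm_splitSteps hij hα hc hi hj ((hl.contDiffAt hz).differentiableAt (by simp)),
    ← h2] at h1
  have hchain : mfderiv (𝓡 (2 * (n + 1 - 3))) (𝓡 (2 * (n + 2 - 3)))
      (splitMap hij hc hi hj ∘ φ.symm) z =
      (mfderiv (𝓡 (2 * (n + 1 - 3))) (𝓡 (2 * (n + 2 - 3))) (splitMap hij hc hi hj)
        (φ.symm z)).comp (mfderiv (𝓡 (2 * (n + 1 - 3))) (𝓡 (2 * (n + 1 - 3))) φ.symm z) :=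
    mfderiv_comp z ((contMDiff_splitMap hij hc hi hj).mdifferentiable (by simp) _)
      (hmd.mdifferentiableAt_symm hyt)
  have hsurj : Function.Surjective
      (mfderiv (𝓡 (2 * (n + 1 - 3))) (𝓡 (2 * (n + 1 - 3))) φ.symm z) :=
    hmd.symm.mfderiv_surjective hyt
  have key : TwoForm.pullback (d := 2 * (n + 1 - 3)) (splitMap hij hc hi hj) Ω (φ.symm z) =
      Ω' (φ.symm z) := by
    refine ContinuousAlternatingMap.ext_two
      (V := EuclideanSpace ℝ (Fin (2 * (n + 1 - 3)))) fun u w => ?_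
    obtain ⟨u, rfl⟩ := hsurj u
    obtain ⟨w, rfl⟩ := hsurj w
    have h3 := congrArg (fun f : EuclideanSpace ℝ (Fin (2 * (n + 1 - 3))) [⋀^Fin 2]→L[ℝ] ℝ =>
      f ![u, w]) h1
    have h4 := (TwoForm.pullback_apply (splitMap hij hc hi hj ∘ φ.symm) Ω z u w).symm.trans
      (h3.trans (TwoForm.pullback_apply φ.symm Ω' z u w))
    rw [hchain] at h4
    exact (TwoForm.pullback_apply (splitMap hij hc hi hj) Ω (φ.symm z) _ _).trans h4
  have hy : φ.symm z = y := φ.left_inv (mem_chart_source _ y)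
  rw [hy] at key
  exact key

end Splitting

/-! ### Merging two parallel steps as the inverse of splitting -/

section Merging

variable {n : ℕ} {i j : Fin (n + 2)} (hij : i ≠ j) {c c' γ : ℝ} {α : Fin (n + 2) → ℝ}
  {D : Set (PolygonSpace α)}

/-- The map `D → M(α')` induced by merging the steps `i` and `j`, where `D` consists of the classes
of polygons whose steps `i` and `j` are in the ratio `c : c'`. -/
noncomputable def mergeMap (hα : ∀ k, 0 < α k) (hc : c + c' = 1) (hi : |c| * γ = α i)
    (hD : ∀ v : closedPolygons α, PolygonSpace.mk v ∈ D ↔ c' • v.1 i = c • v.1 j) :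
    D → PolygonSpace (dropTwoAppend i j hij α γ) := fun x =>
  PolygonSpace.mk ⟨mergeSteps i j hij x.1.out.1,
    mergeSteps_mem hij hα hc hi x.1.out.2 ((hD _).1 (by
      change Quotient.mk _ x.1.out ∈ D
      rw [Quotient.out_eq]
      exact x.2))⟩

/-- The definition uses a chosen representative; any other one differs by a rotation, which commutes
with merging. -/
theorem mergeMap_mk (hα : ∀ k, 0 < α k) (hc : c + c' = 1) (hi : |c| * γ = α i)
    (hD : ∀ v : closedPolygons α, PolygonSpace.mk v ∈ D ↔ c' • v.1 i = c • v.1 j)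
    (v : closedPolygons α) (hv : PolygonSpace.mk v ∈ D) :
    mergeMap hij hα hc hi hD ⟨PolygonSpace.mk v, hv⟩ = PolygonSpace.mk
      ⟨mergeSteps i j hij v.1, mergeSteps_mem hij hα hc hi v.2 ((hD v).1 hv)⟩ := by
  obtain ⟨A, hA, h⟩ := PolygonSpace.mk_eq_mk.1 (Quotient.out_eq (PolygonSpace.mk v))
  exact PolygonSpace.mk_eq_mk.2 ⟨A, hA, by rw [rotate_mergeSteps, h]⟩

theorem continuous_mergeMap (hα : ∀ k, 0 < α k) (hc : c + c' = 1) (hi : |c| * γ = α i)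
    (hD : ∀ v : closedPolygons α, PolygonSpace.mk v ∈ D ↔ c' • v.1 i = c • v.1 j) :
    Continuous (mergeMap hij hα hc hi hD) := by
  -- An open quotient map stays one over any subset, so continuity on `D` can be tested on
  -- representatives.
  have hq : IsOpenQuotientMap (D.restrictPreimage (PolygonSpace.mk (α := α))) :=
    ⟨Set.restrictPreimage_surjective D PolygonSpace.isOpenQuotientMap_mk.surjective,
      PolygonSpace.isOpenQuotientMap_mk.continuous.restrictPreimage,
      PolygonSpace.isOpenQuotientMap_mk.isOpenMap.restrictPreimage D⟩
  refine hq.continuous_comp_iff.1 ?_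
  have h : mergeMap hij hα hc hi hD ∘ D.restrictPreimage (PolygonSpace.mk (α := α)) =
      fun v => PolygonSpace.mk ⟨mergeSteps i j hij v.1.1,
        mergeSteps_mem hij hα hc hi v.1.2 ((hD v.1).1 v.2)⟩ :=
    funext fun v => mergeMap_mk hij hα hc hi hD v.1 v.2
  rw [h]
  exact PolygonSpace.isOpenQuotientMap_mk.continuous.comp
    (((continuous_mergeSteps hij).comp
      (continuous_subtype_val.comp continuous_subtype_val)).subtype_mk _)

theorem splitMap_mem (hc : c + c' = 1) (hi : |c| * γ = α i) (hj : |c'| * γ = α j)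
    (hD : ∀ v : closedPolygons α, PolygonSpace.mk v ∈ D ↔ c' • v.1 i = c • v.1 j)
    (y : PolygonSpace (dropTwoAppend i j hij α γ)) : splitMap hij hc hi hj y ∈ D := by
  induction y using Quotient.inductionOn with
  | h w =>
    refine (hD ⟨splitSteps hij c c' w.1, splitSteps_mem hij hc hi hj w.2⟩).2 ?_
    change c' • splitSteps hij c c' w.1 i = c • splitSteps hij c c' w.1 j
    rw [splitSteps_left, splitSteps_right, smul_comm]

theorem splitMap_mergeMap (hα : ∀ k, 0 < α k) (hc : c + c' = 1) (hi : |c| * γ = α i)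
    (hj : |c'| * γ = α j)
    (hD : ∀ v : closedPolygons α, PolygonSpace.mk v ∈ D ↔ c' • v.1 i = c • v.1 j) (x : D) :
    splitMap hij hc hi hj (mergeMap hij hα hc hi hD x) = x.1 := by
  obtain ⟨x, hx⟩ := x
  induction x using Quotient.inductionOn with
  | h v =>
    refine (congrArg _ (mergeMap_mk hij hα hc hi hD v hx)).trans ?_
    exact congrArg PolygonSpace.mk (Subtype.ext (splitSteps_mergeSteps hij hc ((hD v).1 hx)))

/-- `mergeMap` as a homeomorphism. -/
noncomputable def mergeHomeomorph (hα : ∀ k, 0 < α k) (hc : c + c' = 1) (hi : |c| * γ = α i)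
    (hj : |c'| * γ = α j)
    (hD : ∀ v : closedPolygons α, PolygonSpace.mk v ∈ D ↔ c' • v.1 i = c • v.1 j) :
    D ≃ₜ PolygonSpace (dropTwoAppend i j hij α γ) where
  toFun := mergeMap hij hα hc hi hD
  invFun y := ⟨splitMap hij hc hi hj y, splitMap_mem hij hc hi hj hD y⟩
  left_inv x := Subtype.ext (splitMap_mergeMap hij hα hc hi hj hD x)
  right_inv y := by
    induction y using Quotient.inductionOn with
    | h w =>
      refine (mergeMap_mk hij hα hc hi hD
        ⟨splitSteps hij c c' w.1, splitSteps_mem hij hc hi hj w.2⟩ _).trans ?_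
      exact congrArg PolygonSpace.mk (Subtype.ext (mergeSteps_splitSteps hij hc w.1))
  continuous_toFun := continuous_mergeMap hij hα hc hi hD
  continuous_invFun := (continuous_splitMap hij hc hi hj).subtype_mk _

theorem exists_isSubmanifoldSymplectomorphism [IsPolygonManifold α]
    [IsPolygonManifold (dropTwoAppend i j hij α γ)]
    (hα : ∀ k, 0 < α k) (hc : c + c' = 1) (hi : |c| * γ = α i) (hj : |c'| * γ = α j)
    (hD : ∀ v : closedPolygons α, PolygonSpace.mk v ∈ D ↔ c' • v.1 i = c • v.1 j)
    {Ω : TwoForm (2 * (n + 2 - 3)) (PolygonSpace α)} (hΩ : IsReducedForm α Ω)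
    {Ω' : TwoForm (2 * (n + 1 - 3)) (PolygonSpace (dropTwoAppend i j hij α γ))}
    (hΩ' : IsReducedForm (dropTwoAppend i j hij α γ) Ω') (hs : IsSymplecticForm Ω') :
    ∃ s : D → PolygonSpace (dropTwoAppend i j hij α γ),
      (∀ (v : closedPolygons α) (hv : PolygonSpace.mk v ∈ D),
        ∃ h : mergeSteps i j hij v.1 ∈ closedPolygons (dropTwoAppend i j hij α γ),
          s ⟨PolygonSpace.mk v, hv⟩ = PolygonSpace.mk ⟨mergeSteps i j hij v.1, h⟩) ∧
      IsSubmanifoldSymplectomorphism Ω D Ω' s :=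
  ⟨mergeMap hij hα hc hi hD, fun v hv => ⟨_, mergeMap_mk hij hα hc hi hD v hv⟩,
    isSubmanifoldSymplectomorphism_of_homeomorph hs (mergeHomeomorph hij hα hc hi hj hD)
      (contMDiff_splitMap hij hc hi hj) (splitMap_mergeMap hij hα hc hi hj hD)
      (pullback_splitMap hij hα hc hi hj hΩ hΩ')⟩

end Merging

/-! ### The loci $D_{i,j}^\pm$ as fixed-ratio conditions -/

section ParallelLoci

variable {m : ℕ} {α : Fin m → ℝ} {i j : Fin m}

/-- The loci are defined with separate representatives for parallelism and for the sign. Invariance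
under rotations allows both conditions to be read on one given polygon. -/
theorem exists_mk_eq_iff {P : (Fin m → E3) → Prop}
    (hP : ∀ A ∈ Matrix.specialOrthogonalGroup (Fin 3) ℝ, ∀ v, P v → P (rotate A v))
    (v : closedPolygons α) :
    (∃ w : closedPolygons α, PolygonSpace.mk w = PolygonSpace.mk v ∧ P w.1) ↔ P v.1 := by
  refine ⟨fun ⟨w, h, hw⟩ => ?_, fun h => ⟨v, rfl, h⟩⟩
  obtain ⟨A, hA, h'⟩ := PolygonSpace.mk_eq_mk.1 h
  rw [← h']
  exact hP A hA _ hw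

theorem mk_mem_parallelLocus_iff (v : closedPolygons α) :
    PolygonSpace.mk v ∈ parallelLocus α i j ↔ ∃ c : ℝ, v.1 j = c • v.1 i :=
  exists_mk_eq_iff (P := fun v => ∃ c : ℝ, v j = c • v i) (by
    rintro A - v ⟨c, h⟩
    exact ⟨c, by rw [rotate, h, map_smul]; rfl⟩) v

theorem mk_mem_parallelLocusPos_iff (v : closedPolygons α) :
    PolygonSpace.mk v ∈ parallelLocusPos α i j ↔
      (∃ c : ℝ, v.1 j = c • v.1 i) ∧ 0 < inner ℝ (v.1 i) (v.1 j) :=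
  and_congr (mk_mem_parallelLocus_iff v)
    (exists_mk_eq_iff (P := fun v => 0 < inner ℝ (v i) (v j)) (by
      intro A hA v h
      exact h.trans_eq (inner_act hA _ _).symm) v)

theorem mk_mem_parallelLocusNeg_iff (v : closedPolygons α) :
    PolygonSpace.mk v ∈ parallelLocusNeg α i j ↔
      (∃ c : ℝ, v.1 j = c • v.1 i) ∧ inner ℝ (v.1 i) (v.1 j) < 0 :=
  and_congr (mk_mem_parallelLocus_iff v)
    (exists_mk_eq_iff (P := fun v => inner ℝ (v i) (v j) < 0) (by
      intro A hA v h
      exact (inner_act hA _ _).trans_lt h) v)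

/-- For fixed lengths, both sides say that the unit vectors $x/a$ and $y/b$ agree. -/
theorem parallel_pos_iff {x y : E3} {a b : ℝ} (ha : 0 < a) (hb : 0 < b) (hx : ‖x‖ = a)
    (hy : ‖y‖ = b) : ((∃ c : ℝ, y = c • x) ∧ 0 < inner ℝ x y) ↔ b • x = a • y := by
  constructor
  · rintro ⟨⟨c, rfl⟩, h⟩
    rw [inner_smul_right, real_inner_self_eq_norm_sq, hx] at h
    have hc : 0 < c := pos_of_mul_pos_left h (by positivity)
    rw [norm_smul, hx, Real.norm_of_nonneg hc.le] at hy
    rw [smul_smul, ← hy, mul_comm]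
  · intro h
    have hyx : y = (b / a) • x := by
      rw [div_eq_inv_mul, mul_smul, h, smul_smul, inv_mul_cancel₀ ha.ne', one_smul]
    refine ⟨⟨_, hyx⟩, ?_⟩
    rw [hyx, inner_smul_right, real_inner_self_eq_norm_sq, hx]
    positivity

theorem parallel_neg_iff {x y : E3} {a b : ℝ} (ha : 0 < a) (hb : 0 < b) (hx : ‖x‖ = a)
    (hy : ‖y‖ = b) : ((∃ c : ℝ, y = c • x) ∧ inner ℝ x y < 0) ↔ -b • x = a • y := by
  have h := parallel_pos_iff (y := -y) ha hb hx (by rw [norm_neg, hy])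
  rw [inner_neg_right, Left.neg_pos_iff, smul_neg] at h
  rw [neg_smul, neg_eq_iff_eq_neg, ← h]
  refine and_congr_left fun _ => ⟨fun ⟨c, hc⟩ => ⟨-c, by rw [hc, neg_smul]⟩, fun ⟨c, hc⟩ =>
    ⟨-c, by rw [neg_smul, ← hc, neg_neg]⟩⟩

end ParallelLoci

/-! ### The two signs -/

theorem mainTheorem9 {n : ℕ} (α : Fin (n + 2) → ℝ) (hpos : ∀ k, 0 < α k) (hgen : IsGeneric α)
    (i j : Fin (n + 2)) (hij : i ≠ j) (hne : α i ≠ α j) :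
    ∃ (_ : IsPolygonManifold α)
      (_ : IsPolygonManifold (lengthsPos α i j hij))
      (_ : IsPolygonManifold (lengthsNeg α i j hij))
      (Ω : TwoForm (2 * (n + 2 - 3)) (PolygonSpace α))
      (Ωp : TwoForm (2 * (n + 1 - 3)) (PolygonSpace (lengthsPos α i j hij)))
      (Ωn : TwoForm (2 * (n + 1 - 3)) (PolygonSpace (lengthsNeg α i j hij))),
      (IsReducedForm α Ω ∧ IsSymplecticForm Ω) ∧
      (IsReducedForm (lengthsPos α i j hij) Ωp ∧ IsSymplecticForm Ωp) ∧
      (IsReducedForm (lengthsNeg α i j hij) Ωn ∧ IsSymplecticForm Ωn) ∧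
      (∃ s : parallelLocusPos α i j → PolygonSpace (lengthsPos α i j hij),
        (∀ (v : closedPolygons α) (hv : PolygonSpace.mk v ∈ parallelLocusPos α i j),
          ∃ h : mergeSteps i j hij v.1 ∈ closedPolygons (lengthsPos α i j hij),
            s ⟨PolygonSpace.mk v, hv⟩ = PolygonSpace.mk ⟨mergeSteps i j hij v.1, h⟩) ∧
        IsSubmanifoldSymplectomorphism Ω (parallelLocusPos α i j) Ωp s) ∧
      (∃ s : parallelLocusNeg α i j → PolygonSpace (lengthsNeg α i j hij),
        (∀ (v : closedPolygons α) (hv : PolygonSpace.mk v ∈ parallelLocusNeg α i j),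
          ∃ h : mergeSteps i j hij v.1 ∈ closedPolygons (lengthsNeg α i j hij),
            s ⟨PolygonSpace.mk v, hv⟩ = PolygonSpace.mk ⟨mergeSteps i j hij v.1, h⟩) ∧
        IsSubmanifoldSymplectomorphism Ω (parallelLocusNeg α i j) Ωn s) := by
  have hsum : 0 < α i + α j := add_pos (hpos i) (hpos j)
  have hsub : α i - α j ≠ 0 := sub_ne_zero.2 hne
  have hpc : α i / (α i + α j) + α j / (α i + α j) = 1 := by field_simp
  have hpi : |α i / (α i + α j)| * (α i + α j) = α i := by
    rw [abs_of_pos (div_pos (hpos i) hsum)]; field_simp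
  have hpj : |α j / (α i + α j)| * (α i + α j) = α j := by
    rw [abs_of_pos (div_pos (hpos j) hsum)]; field_simp
  -- For opposite directions $v_i+v_j=\frac{\alpha_i-\alpha_j}{\alpha_i}v_i$. The denominator is the
  -- signed difference while the length is its absolute value, so both orders of $\alpha_i,\alpha_j$
  -- are covered at once.
  have hnc : α i / (α i - α j) + -α j / (α i - α j) = 1 := by field_simp; ring
  have hni : |α i / (α i - α j)| * |α i - α j| = α i := by
    rw [← abs_mul, div_mul_cancel₀ _ hsub, abs_of_pos (hpos i)]
  have hnj : |-α j / (α i - α j)| * |α i - α j| = α j := by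
    rw [← abs_mul, div_mul_cancel₀ _ hsub, abs_neg, abs_of_pos (hpos j)]
  have hp0 : ∀ k, 0 < lengthsPos α i j hij k := dropTwoAppend_pos hij hpos hsum
  have hn0 : ∀ k, 0 < lengthsNeg α i j hij k := dropTwoAppend_pos hij hpos (abs_pos.2 hsub)
  have hpg : IsGeneric (lengthsPos α i j hij) := isGeneric_dropTwoAppend hij hpos hgen hpc hpi hpj
  have hng : IsGeneric (lengthsNeg α i j hij) := isGeneric_dropTwoAppend hij hpos hgen hnc hni hnj
  have I := isPolygonManifold hpos hgen
  have Ip : IsPolygonManifold (lengthsPos α i j hij) := isPolygonManifold hp0 hpg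
  have In : IsPolygonManifold (lengthsNeg α i j hij) := isPolygonManifold hn0 hng
  have hr := isReducedForm_reducedForm hpos hgen
  have hrp := isReducedForm_reducedForm hp0 hpg
  have hrn := isReducedForm_reducedForm hn0 hng
  have hsp := isSymplecticForm_of_isReducedForm hp0 hpg hrp
  have hsn := isSymplecticForm_of_isReducedForm hn0 hng hrn
  -- The common denominator of the two coefficients drops out of the ratio condition.
  have hscale : ∀ (x y : E3) (a b s : ℝ), s ≠ 0 →
      ((b / s) • x = (a / s) • y ↔ b • x = a • y) := by
    intro x y a b s hs
    rw [div_eq_inv_mul, div_eq_inv_mul, mul_smul, mul_smul]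
    exact smul_right_injective E3 (inv_ne_zero hs) |>.eq_iff
  refine ⟨I, Ip, In, reducedForm α, reducedForm _, reducedForm _,
    ⟨hr, isSymplecticForm_of_isReducedForm hpos hgen hr⟩, ⟨hrp, hsp⟩, ⟨hrn, hsn⟩, ?_, ?_⟩
  · have : IsPolygonManifold (dropTwoAppend i j hij α (α i + α j)) := Ip
    exact exists_isSubmanifoldSymplectomorphism hij hpos hpc hpi hpj (fun v => by
      rw [mk_mem_parallelLocusPos_iff, hscale _ _ _ _ _ hsum.ne']
      exact parallel_pos_iff (hpos i) (hpos j) (v.2.1 i) (v.2.1 j)) hr hrp hsp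
  · have : IsPolygonManifold (dropTwoAppend i j hij α |α i - α j|) := In
    exact exists_isSubmanifoldSymplectomorphism hij hpos hnc hni hnj (fun v => by
      rw [mk_mem_parallelLocusNeg_iff, hscale _ _ _ _ _ hsub]
      exact parallel_neg_iff (hpos i) (hpos j) (v.2.1 i) (v.2.1 j)) hr hrn hsn
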